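/- Let $\Gamma$ be a profinite group and let $\ell$ be a prime number. Let $\Gamma\text{-mod}_\ell$ be the abelian category of finite abelian $\ell$-groups equipped with a discrete action of $\Gamma$ (i.e. an action by group automorphisms such that the stabilizer of every element is open), with $\Gamma$-equivariant homomorphisms as morphisms. Let $\mathrm{hd}(\Gamma\text{-mod}_\ell)$ be its homological dimension, i.e. the smallest integer $n \ge 0$ such that $\mathrm{Ext}^i(X,Y) = 0$ for all objects $X, Y$ of $\Gamma\text{-mod}_\ell$ and all $i > n$, and $\infty$ if there is no such $n$. Let $\mathrm{cd}_\ell(\Gamma)$ be the $\ell$-th cohomological dimension of $\Gamma$, i.e. the smallest integer $n$ such that $H^i(\Gamma, M) = 0$ for all $i > n$ and all $\ell$-primary torsion discrete $\Gamma$-modules $M$, and $\infty$ if there is no such $n$. Then \[ \mathrm{hd}(\Gamma\text{-mod}_\ell) = \mathrm{cd}_\ell(\Gamma) + 1, \] with the convention $\infty + 1 = \infty$. -/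

import Mathlib

open CategoryTheory Limits Abelian

universe u v

section HomologicalDimension

/-- The homological dimension of an abelian category: the smallest `n` (possibly `⊤`) such that
`Ext^i(X, Y) = 0` for all objects `X`, `Y` and all `i > n`. -/
noncomputable def homologicalDimension (C : Type u) [Category.{v} C] [Abelian C] : ℕ∞ :=
  letI := HasExt.standard C
  sInf {n : ℕ∞ | ∀ i : ℕ, n < (i : ℕ∞) → ∀ X Y : C, Subsingleton (Ext.{max u v} X Y i)}

end HomologicalDimension

section DiscreteModules

/-- The property of a `k`-linear `Γ`-module (a `Γ`-module for `k = ℤ`) of being a finite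
`ℓ`-group with discrete action of `Γ`, i.e. with open stabilizers. -/
structure IsFiniteDiscretePrimary (k : Type v) [CommRing k] (Γ : Type u) [Group Γ]
    [TopologicalSpace Γ] (ℓ : ℕ) (M : Rep.{u} k Γ) : Prop where
  finite : Finite M.V
  primary : ∀ m : M.V, ∃ n : ℕ, ℓ ^ n • m = 0
  discrete : ∀ m : M.V, IsOpen {g : Γ | M.ρ g m = m}

/-- `IsFiniteDiscretePrimary` as a property of objects of the category of `k`-linear `Γ`-modules. -/
def finiteDiscretePrimary (k : Type v) [CommRing k] (Γ : Type u) [Group Γ] [TopologicalSpace Γ]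
    (ℓ : ℕ) : ObjectProperty (Rep.{u} k Γ) :=
  fun M => IsFiniteDiscretePrimary k Γ ℓ M

/-- The category of finite abelian `ℓ`-groups with discrete action of `Γ`, and `Γ`-equivariant
homomorphisms. -/
abbrev FinDiscMod (Γ : Type u) [Group Γ] [TopologicalSpace Γ] (ℓ : ℕ) : Type (u + 1) :=
  (finiteDiscretePrimary ℤ Γ ℓ).FullSubcategory

variable {k : Type v} [CommRing k] {Γ : Type u} [Group Γ] [TopologicalSpace Γ] {ℓ : ℕ}

lemma isFiniteDiscretePrimary_of_jointly_injective {J : Type*} [Finite J] {A : Rep.{u} k Γ}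
    {B : J → Rep.{u} k Γ} (f : ∀ j, A ⟶ B j)
    (hf : ∀ x y : A.V, (∀ j, (f j).hom x = (f j).hom y) → x = y)
    (hB : ∀ j, IsFiniteDiscretePrimary k Γ ℓ (B j)) : IsFiniteDiscretePrimary k Γ ℓ A where
  finite := by
    have := fun j => (hB j).finite
    exact Finite.of_injective (fun (x : A.V) (j : J) => (f j).hom x)
      fun x y h => hf x y fun j => congrFun h j
  primary m := by
    classical
    have := Fintype.ofFinite J
    choose n hn using fun j => (hB j).primary ((f j).hom m)
    refine ⟨∑ j, n j, hf _ _ fun j => ?_⟩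
    rw [map_nsmul, map_zero, ← Finset.sum_erase_add _ _ (Finset.mem_univ j), pow_add, mul_smul,
      hn j, smul_zero]
  discrete m := by
    have : {g : Γ | A.ρ g m = m} =
        ⋂ j, {g : Γ | (B j).ρ g ((f j).hom m) = (f j).hom m} := by
      ext g
      simp only [Set.mem_ofPred_eq, Set.mem_iInter, ← Rep.hom_comm_apply]
      exact ⟨fun h j => by rw [h], fun h => hf _ _ h⟩
    rw [this]
    exact isOpen_iInter_of_finite fun j => (hB j).discrete _

lemma isFiniteDiscretePrimary_of_surjective [IsTopologicalGroup Γ] {A B : Rep.{u} k Γ}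
    (f : A ⟶ B) (hf : Function.Surjective f.hom) (hA : IsFiniteDiscretePrimary k Γ ℓ A) :
    IsFiniteDiscretePrimary k Γ ℓ B where
  finite := by
    have := hA.finite
    exact Finite.of_surjective _ hf
  primary m := by
    obtain ⟨a, rfl⟩ := hf m
    obtain ⟨n, hn⟩ := hA.primary a
    exact ⟨n, by rw [← map_nsmul, hn, map_zero]⟩
  discrete m := by
    obtain ⟨a, rfl⟩ := hf m
    let S : Subgroup Γ :=
      { carrier := {g | B.ρ g (f.hom a) = f.hom a}
        one_mem' := by simp
        mul_mem' := fun {g h} hg hh => by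
          simp only [Set.mem_ofPred_eq] at hg hh ⊢
          have : B.ρ (g * h) (f.hom a) = B.ρ g (B.ρ h (f.hom a)) := by rw [map_mul]; rfl
          rw [this, hh, hg]
        inv_mem' := fun {g} hg => by
          simp only [Set.mem_ofPred_eq] at hg ⊢
          conv_lhs => rw [← hg]
          simp }
    change IsOpen (S : Set Γ)
    refine S.isOpen_of_mem_nhds (g := 1) (Filter.mem_of_superset
      ((hA.discrete a).mem_nhds (by simp)) fun g hg => ?_)
    change B.ρ g (f.hom a) = f.hom a
    rw [← Rep.hom_comm_apply, show A.ρ g a = a from hg]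

instance : (finiteDiscretePrimary k Γ ℓ).IsClosedUnderSubobjects where
  prop_of_mono f _ hY :=
    isFiniteDiscretePrimary_of_jointly_injective (J := Unit) (fun _ => f)
      (fun _ _ h => (Rep.mono_iff_injective f).1 inferInstance (h ())) fun _ => hY

instance [IsTopologicalGroup Γ] : (finiteDiscretePrimary k Γ ℓ).IsClosedUnderQuotients where
  prop_of_epi f _ hX :=
    isFiniteDiscretePrimary_of_surjective f ((Rep.epi_iff_surjective f).1 inferInstance) hX

instance : (finiteDiscretePrimary k Γ ℓ).IsClosedUnderFiniteProducts where
  isClosedUnderLimitsOfShape J _ := ⟨by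
    rintro X ⟨p⟩
    exact isFiniteDiscretePrimary_of_jointly_injective (fun j => p.π.app ⟨j⟩)
      (fun x y h => Concrete.isLimit_ext _
        (isLimitOfPreserves (forget₂ (Rep.{u} k Γ) (ModuleCat.{u} k)) p.isLimit) x y
        fun j => h j.as)
      fun j => p.prop_diag_obj ⟨j⟩⟩

instance : (finiteDiscretePrimary k Γ ℓ).ContainsZero where
  exists_zero := ⟨Rep.of (Representation.trivial k Γ PUnit.{u + 1}), by
    rw [IsZero.iff_id_eq_zero]; ext, by
    exact isFiniteDiscretePrimary_of_jointly_injective (J := Empty) (B := fun j => j.elim)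
      (fun j => j.elim) (fun _ _ _ => rfl) fun j => j.elim⟩

end DiscreteModules

section CohomologicalDimension

/-- The `ℓ`-th cohomological dimension of `Γ`: the smallest `n` (possibly `⊤`) such that
`H^i(Γ, M) = 0` for all `i > n` and all `ℓ`-primary torsion discrete `Γ`-modules `M`. -/
noncomputable def cohomologicalDimension (Γ : Type u) [Group Γ] [TopologicalSpace Γ]
    [IsTopologicalGroup Γ] (ℓ : ℕ) : ℕ∞ :=
  sInf {n : ℕ∞ | ∀ i : ℕ, n < (i : ℕ∞) → ∀ M : TopRep.{u} ℤ Γ,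
    DiscreteTopology M.V → (∀ m : M.V, IsOpen {g : Γ | M.ρ g m = m}) →
    (∀ m : M.V, ∃ k : ℕ, ℓ ^ k • m = 0) → Subsingleton (continuousCohomology i M)}

end CohomologicalDimension

/-!
The bridge between the two sides is the abelian category of all discrete `Γ`-modules.

* `continuousCohomology (n + 1) M` is `Ext (ℤ, M)` there: the standard resolution of `M` by
  continuous cochains consists of coinduced modules, and `Ext (P, -)` vanishes on those when `P` is
  free over `ℤ`.
* `Ext` of finite `ℓ`-primary modules does not change when passing to all discrete modules, because
  every higher class is killed by an epimorphism from a finite `ℓ`-primary module.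

For the upper bound, embed `Y` into an injective `ℓ`-primary module `J`. The quotient `Q = J / Y` is
divisible, hence injective as an abelian group, so that `Hom (X, -)` is exact along an injective
resolution of `Q` and `Ext^(n + 2) (X, Y) = Ext^(n + 1) (X, Q) = H^(n + 1) (Γ, Hom (X, Q))`.

For the lower bound, let `N` be finite and `ℓ`-primary. If `Ext^(n + 1) (ℤ/ℓ, N) = 0`, then the
sequence `0 → ℤ → ℤ → ℤ/ℓ → 0` makes `Ext^n (ℤ, N) = H^n (Γ, N)` divisible by `ℓ`, hence zero since
a power of `ℓ` kills it. Cohomology of an arbitrary `ℓ`-primary module reduces to its finite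
submodules, as cochains take finitely many values. Finally `Ext^1 (ℤ/ℓ, ℤ/ℓ) ≠ 0` by the same
argument, so the homological dimension is positive.
-/

section Effaceability

universe w w' u₁ v₁ u₂ v₂

variable {C : Type u₁} [Category.{v₁} C] [Abelian C]

open HomologicalComplex in
lemma exists_epi_single_map_eq_comp {X : C} {K : CochainComplex C ℤ}
    (s : K ⟶ (single C (ComplexShape.up ℤ) 0).obj X) [QuasiIsoAt s 0] :
    ∃ (X' : C) (p : X' ⟶ X) (t : (single C (ComplexShape.up ℤ) 0).obj X' ⟶ K),
      Epi p ∧ t ≫ s = (single C (ComplexShape.up ℤ) 0).map p := by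
  obtain ⟨X', p, hp, z, hz, hpz⟩ := K.eq_liftCycles_homologyπ_up_to_refinements
    ((singleObjHomologySelfIso (ComplexShape.up ℤ) 0 X).inv ≫ inv (homologyMap s 0)) 1 (by simp)
  refine ⟨X', p, mkHomFromSingle z fun j hj => ?_, hp, ?_⟩
  · obtain rfl : 0 + 1 = j := hj
    exact hz
  · have hps : p = K.liftCycles z 1 (by simp) hz ≫ K.homologyπ 0 ≫ homologyMap s 0 ≫
        (singleObjHomologySelfIso (ComplexShape.up ℤ) 0 X).hom := by
      rw [← reassoc_of% hpz, IsIso.inv_hom_id_assoc, Iso.inv_hom_id, Category.comp_id]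
    apply from_single_hom_ext
    have hcycles := singleObjCyclesSelfIso_inv_iCycles (ComplexShape.up ℤ) 0 X
    rw [Iso.inv_comp_eq] at hcycles
    simp [single_map_f_self, hps, homologyπ_naturality_assoc, ← hcycles]

lemma exists_epi_map_singleFunctor_comp_eq_zero [HasDerivedCategory.{w} C] {X : C}
    {L : CochainComplex C ℤ} [L.IsStrictlyLE (-1)]
    (φ : DerivedCategory.Q.obj ((CochainComplex.singleFunctor C 0).obj X) ⟶
      DerivedCategory.Q.obj L) :
    ∃ (X' : C) (p : X' ⟶ X), Epi p ∧
      DerivedCategory.Q.map ((CochainComplex.singleFunctor C 0).map p) ≫ φ = 0 := by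
  obtain ⟨K, s, hs, g, rfl⟩ := DerivedCategory.right_fac φ
  have : QuasiIso s := by rwa [DerivedCategory.isIso_Q_map_iff_quasiIso] at hs
  have : QuasiIsoAt (L := (HomologicalComplex.single C (ComplexShape.up ℤ) 0).obj X) s 0 :=
    this.quasiIsoAt 0
  obtain ⟨X', p, (t : (CochainComplex.singleFunctor C 0).obj X' ⟶ K), hp, hts⟩ :=
    exists_epi_single_map_eq_comp s
  have hts' : (CochainComplex.singleFunctor C 0).map p = t ≫ s := hts.symm
  have htg : t ≫ g = 0 := by
    apply HomologicalComplex.from_single_hom_ext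
    exact (L.isZero_of_isStrictlyLE (-1) 0 (by lia)).eq_of_tgt _ _
  refine ⟨X', p, hp, ?_⟩
  rw [hts', Functor.map_comp, Category.assoc, IsIso.hom_inv_id_assoc, ← Functor.map_comp, htg,
    Functor.map_zero]

lemma exists_epi_mk₀_comp_eq_zero [HasExt.{w} C] {X Y : C} {n : ℕ} (e : Ext X Y (n + 1)) :
    ∃ (X' : C) (p : X' ⟶ X), Epi p ∧ (Ext.mk₀ p).comp e (zero_add _) = 0 := by
  let := HasDerivedCategory.standard C
  let shift := ((DerivedCategory.singleFunctors C).shiftIso ((n + 1 : ℕ) : ℤ) (-(n + 1 : ℕ)) 0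
    (by lia)).hom.app Y
  have : ((CochainComplex.singleFunctor C (-(n + 1 : ℕ))).obj Y).IsStrictlyLE (-1) :=
    CochainComplex.isStrictlyLE_of_le _ (-(n + 1 : ℕ)) (-1) (by lia)
  obtain ⟨X', p, hp, h⟩ := exists_epi_map_singleFunctor_comp_eq_zero (X := X)
    (L := (CochainComplex.singleFunctor C (-(n + 1 : ℕ))).obj Y) (e.hom ≫ shift)
  refine ⟨X', p, hp, Ext.homEquiv.injective ?_⟩
  have hcomp : Ext.homEquiv ((Ext.mk₀ p).comp e (zero_add (n + 1))) =
      (DerivedCategory.singleFunctor C 0).map p ≫ e.hom :=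
    (Ext.singleFunctor_map_comp_hom _ _).symm
  have hzero : Ext.homEquiv (0 : Ext X' Y (n + 1)) = 0 := Ext.zero_hom X' Y (n + 1)
  rw [hcomp, hzero, ← cancel_mono shift, zero_comp]
  exact (Category.assoc _ _ _).trans h

variable {D : Type u₂} [Category.{v₂} D] [Abelian D]

/-- Induction on the degree: both sides are computed by the connecting homomorphism of an
epimorphism onto `X` which kills the given classes. -/
lemma mapExtAddHom_bijective_of_effaceable (F : C ⥤ D) [F.Additive]
    [PreservesFiniteLimits F] [PreservesFiniteColimits F] [F.Full] [F.Faithful] [HasExt.{w} C]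
    [HasExt.{w'} D]
    (hF : ∀ (X Y : C) (n : ℕ) (e : Ext.{w'} (F.obj X) (F.obj Y) (n + 1)), ∃ (X' : C) (p : X' ⟶ X),
      Epi p ∧ (Ext.mk₀ (F.map p)).comp e (zero_add _) = 0)
    (X Y : C) (n : ℕ) : Function.Bijective (F.mapExtAddHom X Y n) := by
  induction n generalizing X with
  | zero =>
    simpa [Ext.mapExactFunctor₀] using!
      ⟨Functor.Faithful.map_injective, Functor.Full.map_surjective⟩
  | succ n hn =>
    have hS {X' : C} (p : X' ⟶ X) [Epi p] :
        (ShortComplex.mk _ _ (kernel.condition p)).ShortExact :=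
      { exact := ShortComplex.exact_kernel p }
    refine ⟨(injective_iff_map_eq_zero _).2 fun a ha => ?_, fun e => ?_⟩
    · obtain ⟨X', p, _, hpa⟩ := exists_epi_mk₀_comp_eq_zero a
      obtain ⟨a', rfl⟩ := Ext.contravariant_sequence_exact₃ (hS p) _ a hpa (add_comm 1 n)
      rw [Functor.mapExtAddHom_apply, Ext.mapExactFunctor_comp, Ext.mapExactFunctor_extClass] at ha
      obtain ⟨b, hb⟩ := Ext.contravariant_sequence_exact₁ ((hS p).map_of_exact F) _ _ _ ha
      obtain ⟨b', rfl⟩ := (hn X').2 b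
      obtain rfl : (Ext.mk₀ (kernel.ι p)).comp b' (zero_add n) = a' := (hn _).1 <| by
        rw [Functor.mapExtAddHom_apply, Ext.mapExactFunctor_comp, Ext.mapExactFunctor_mk₀]
        exact hb
      exact (hS p).extClass_comp_assoc _
    · obtain ⟨X', p, _, hpe⟩ := hF X Y n e
      obtain ⟨e', rfl⟩ := Ext.contravariant_sequence_exact₃ ((hS p).map_of_exact F) _ e hpe
        (add_comm 1 n)
      obtain ⟨a', rfl⟩ := (hn _).2 e'
      refine ⟨(hS p).extClass.comp a' (add_comm 1 n), ?_⟩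
      rw [Functor.mapExtAddHom_apply, Ext.mapExactFunctor_comp, Ext.mapExactFunctor_extClass]
      rfl

end Effaceability

section DimensionShifting

universe w u₁ v₁

variable {C : Type u₁} [Category.{v₁} C] [Abelian C] [HasExt.{w} C] {S : ShortComplex C}

lemma subsingleton_ext_X₃_of_shortExact {n : ℕ} (hS : S.ShortExact) (L : C)
    (h₂ : Subsingleton (Ext L S.X₂ n)) (h₁ : Subsingleton (Ext L S.X₁ (n + 1))) :
    Subsingleton (Ext L S.X₃ n) :=
  subsingleton_of_forall_eq 0 fun x => by
    obtain ⟨y, rfl⟩ := Ext.covariant_sequence_exact₃ L hS x rfl (Subsingleton.elim _ _)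
    rw [Subsingleton.elim y 0, Ext.zero_comp]

lemma subsingleton_ext_X₁_of_shortExact {n : ℕ} (hS : S.ShortExact) (L : C)
    (h₃ : Subsingleton (Ext L S.X₃ n)) (h₂ : Subsingleton (Ext L S.X₂ (n + 1))) :
    Subsingleton (Ext L S.X₁ (n + 1)) :=
  subsingleton_of_forall_eq 0 fun x => by
    obtain ⟨y, rfl⟩ := Ext.covariant_sequence_exact₁ L hS x (Subsingleton.elim _ _) rfl
    rw [Subsingleton.elim y 0, Ext.zero_comp]

lemma exists_lift_of_subsingleton_ext_one (hS : S.ShortExact) (L : C)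
    (h : Subsingleton (Ext L S.X₁ 1)) (f : L ⟶ S.X₃) : ∃ g : L ⟶ S.X₂, g ≫ S.g = f := by
  obtain ⟨y, hy⟩ := Ext.covariant_sequence_exact₃ L hS (Ext.mk₀ f) rfl (Subsingleton.elim _ _)
  obtain ⟨g, rfl⟩ := (Ext.mk₀_bijective _ _).2 y
  exact ⟨g, (Ext.mk₀_bijective _ _).1 (by rw [← hy, Ext.mk₀_comp_mk₀])⟩

lemma subsingleton_ext_one_of_exists_lift (hS : S.ShortExact) (L : C)
    (h₂ : Subsingleton (Ext L S.X₂ 1)) (h : ∀ f : L ⟶ S.X₃, ∃ g : L ⟶ S.X₂, g ≫ S.g = f) :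
    Subsingleton (Ext L S.X₁ 1) :=
  subsingleton_of_forall_eq 0 fun x => by
    obtain ⟨y, rfl⟩ := Ext.covariant_sequence_exact₁ L hS x (Subsingleton.elim _ _) rfl
    obtain ⟨f, rfl⟩ := (Ext.mk₀_bijective _ _).2 y
    obtain ⟨g, rfl⟩ := h f
    rw [← Ext.mk₀_comp_mk₀, Ext.comp_assoc_of_second_deg_zero, hS.comp_extClass, Ext.comp_zero]

end DimensionShifting

section AcyclicResolution

universe w u₁ v₁

variable {C : Type u₁} [Category.{v₁} C] [Abelian C]

lemma shortExact_kernelLift {M I₀ I₁ I₂ : C} (i : M ⟶ I₀) [Mono i] (d₀ : I₀ ⟶ I₁) (d₁ : I₁ ⟶ I₂)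
    (hi : i ≫ d₀ = 0) (hd : d₀ ≫ d₁ = 0) (hiex : (ShortComplex.mk i d₀ hi).Exact)
    (hex : (ShortComplex.mk d₀ d₁ hd).Exact) :
    (ShortComplex.mk i (kernel.lift d₁ d₀ hd) (by
      rw [← cancel_mono (kernel.ι d₁)]; simpa using hi)).ShortExact where
  exact := by
    let φ : ShortComplex.mk i (kernel.lift d₁ d₀ hd) (by
        rw [← cancel_mono (kernel.ι d₁)]; simpa using hi) ⟶ ShortComplex.mk i d₀ hi :=
      { τ₁ := 𝟙 _, τ₂ := 𝟙 _, τ₃ := kernel.ι d₁ }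
    exact (ShortComplex.exact_iff_of_epi_of_isIso_of_mono φ).2 hiex
  epi_g := hex.epi_kernelLift

lemma subsingleton_ext_iff_of_acyclic_resolution [HasExt.{w} C] (L : C) (n : ℕ) (I : ℕ → C)
    (d : ∀ k, I k ⟶ I (k + 1)) (hd : ∀ k, d k ≫ d (k + 1) = 0)
    (hex : ∀ k, (ShortComplex.mk _ _ (hd k)).Exact)
    (hI : ∀ k j, Subsingleton (Ext L (I k) (j + 1))) {M : C} (i : M ⟶ I 0) [Mono i]
    (hi : i ≫ d 0 = 0) (hiex : (ShortComplex.mk _ _ hi).Exact) :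
    Subsingleton (Ext L M (n + 1)) ↔
      ∀ f : L ⟶ I (n + 1), f ≫ d (n + 1) = 0 → ∃ g : L ⟶ I n, g ≫ d n = f := by
  induction n generalizing I M with
  | zero =>
    have hS := shortExact_kernelLift i (d 0) (d 1) hi (hd 0) hiex (hex 0)
    refine ⟨fun h f hf => ?_,
      fun h => subsingleton_ext_one_of_exists_lift hS L (hI 0 0) fun f => ?_⟩
    · obtain ⟨g, hg⟩ := exists_lift_of_subsingleton_ext_one hS L h (kernel.lift _ f hf)
      exact ⟨g, by simpa using congr($hg ≫ kernel.ι (d 1))⟩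
    · obtain ⟨g, hg⟩ := h (f ≫ kernel.ι (d 1)) (by simp)
      exact ⟨g, by rw [← cancel_mono (kernel.ι (d 1))]; simpa using hg⟩
  | succ n ih =>
    have hS := shortExact_kernelLift i (d 0) (d 1) hi (hd 0) hiex (hex 0)
    rw [← ih (fun k => I (k + 1)) (fun k => d (k + 1)) (fun k => hd (k + 1))
      (fun k => hex (k + 1)) (fun k => hI (k + 1)) (kernel.ι (d 1)) (kernel.condition _)
      (ShortComplex.exact_kernel _)]
    exact ⟨fun h => subsingleton_ext_X₃_of_shortExact hS L (hI 0 n) h,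
      fun h => subsingleton_ext_X₁_of_shortExact hS L h (hI 0 (n + 1))⟩

end AcyclicResolution

section ExactInclusions

variable {C : Type*} [Category* C] [Abelian C] (P Q : ObjectProperty C)
  [P.ContainsZero] [P.IsClosedUnderKernels] [P.IsClosedUnderCokernels]
  [P.IsClosedUnderFiniteProducts]
  [Q.ContainsZero] [Q.IsClosedUnderKernels] [Q.IsClosedUnderCokernels]
  [Q.IsClosedUnderFiniteProducts]

lemma preservesFiniteLimits_fullSubcategory_ι : PreservesFiniteLimits P.ι := by
  have := P.preservesKernels_ι
  have : P.ι.Additive := inferInstance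
  exact P.ι.preservesFiniteLimits_of_preservesKernels

lemma preservesFiniteColimits_fullSubcategory_ι : PreservesFiniteColimits P.ι := by
  have := P.preservesCokernels_ι
  have : P.ι.Additive := inferInstance
  exact P.ι.preservesFiniteColimits_of_preservesCokernels

lemma preservesFiniteLimits_ιOfLE (h : P ≤ Q) :
    PreservesFiniteLimits (ObjectProperty.ιOfLE h) := by
  have : PreservesFiniteLimits (ObjectProperty.ιOfLE h ⋙ Q.ι) :=
    preservesFiniteLimits_fullSubcategory_ι P
  have := preservesFiniteLimits_fullSubcategory_ι Q
  exact ⟨fun J _ _ => preservesLimitsOfShape_of_reflects_of_preserves _ Q.ι⟩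

lemma preservesFiniteColimits_ιOfLE (h : P ≤ Q) :
    PreservesFiniteColimits (ObjectProperty.ιOfLE h) := by
  have : PreservesFiniteColimits (ObjectProperty.ιOfLE h ⋙ Q.ι) :=
    preservesFiniteColimits_fullSubcategory_ι P
  have := preservesFiniteColimits_fullSubcategory_ι Q
  exact ⟨fun J _ _ => preservesColimitsOfShape_of_reflects_of_preserves _ Q.ι⟩

end ExactInclusions

section OpenStabilizers

variable {k : Type v} [CommRing k] {Γ : Type u} [Group Γ] [TopologicalSpace Γ]

lemma isOpen_stabilizer_iff_isLocallyConstant [ContinuousMul Γ] {V : Type*}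
    [AddCommGroup V] [Module k V] (ρ : Representation k Γ V) (m : V) :
    IsOpen {g : Γ | ρ g m = m} ↔ IsLocallyConstant fun g => ρ g m := by
  refine ⟨fun h => (IsLocallyConstant.iff_exists_open _).2 fun g => ?_, fun h => h.isOpen_fiber m⟩
  refine ⟨{x | ρ (g⁻¹ * x) m = m}, h.preimage (continuous_const_mul g⁻¹), by simp, fun x hx => ?_⟩
  calc ρ x m = ρ (g * (g⁻¹ * x)) m := by rw [mul_inv_cancel_left]
    _ = ρ g m := by rw [map_mul, Module.End.mul_apply, hx]

/-- The property of a `k`-linear `Γ`-module of having open stabilizers. -/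
def openStabilizers (k : Type v) [CommRing k] (Γ : Type u) [Group Γ] [TopologicalSpace Γ] :
    ObjectProperty (Rep.{u} k Γ) :=
  fun M => ∀ m : M.V, IsOpen {g : Γ | M.ρ g m = m}

lemma openStabilizers_of_jointly_injective {J : Type*} [Finite J] {A : Rep.{u} k Γ}
    {B : J → Rep.{u} k Γ} (f : ∀ j, A ⟶ B j)
    (hf : ∀ x y : A.V, (∀ j, (f j).hom x = (f j).hom y) → x = y)
    (hB : ∀ j, openStabilizers k Γ (B j)) : openStabilizers k Γ A := fun m => by
  have : {g : Γ | A.ρ g m = m} = ⋂ j, {g : Γ | (B j).ρ g ((f j).hom m) = (f j).hom m} := by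
    ext g
    simp only [Set.mem_ofPred_eq, Set.mem_iInter, ← Rep.hom_comm_apply]
    exact ⟨fun h j => by rw [h], fun h => hf _ _ h⟩
  rw [this]
  exact isOpen_iInter_of_finite fun j => hB j _

lemma openStabilizers_of_surjective [ContinuousMul Γ] {A B : Rep.{u} k Γ}
    (f : A ⟶ B) (hf : Function.Surjective f.hom) (hA : openStabilizers k Γ A) :
    openStabilizers k Γ B := fun m => by
  obtain ⟨a, rfl⟩ := hf m
  have := ((isOpen_stabilizer_iff_isLocallyConstant _ _).1 (hA a)).comp f.hom
  simpa only [isOpen_stabilizer_iff_isLocallyConstant, Function.comp_def, Rep.hom_comm_apply]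
    using this

instance : (openStabilizers k Γ).IsClosedUnderSubobjects where
  prop_of_mono f _ hY :=
    openStabilizers_of_jointly_injective (J := Unit) (fun _ => f)
      (fun _ _ h => (Rep.mono_iff_injective f).1 inferInstance (h ())) fun _ => hY

instance [ContinuousMul Γ] : (openStabilizers k Γ).IsClosedUnderQuotients where
  prop_of_epi f _ hX :=
    openStabilizers_of_surjective f ((Rep.epi_iff_surjective f).1 inferInstance) hX

instance : (openStabilizers k Γ).IsClosedUnderFiniteProducts where
  isClosedUnderLimitsOfShape J _ := ⟨by
    rintro X ⟨p⟩
    exact openStabilizers_of_jointly_injective (fun j => p.π.app ⟨j⟩)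
      (fun x y h => Concrete.isLimit_ext _
        (isLimitOfPreserves (forget₂ (Rep.{u} k Γ) (ModuleCat.{u} k)) p.isLimit) x y
        fun j => h j.as)
      fun j => p.prop_diag_obj ⟨j⟩⟩

instance : (openStabilizers k Γ).ContainsZero where
  exists_zero := ⟨Rep.of (Representation.trivial k Γ PUnit.{u + 1}), by
    rw [IsZero.iff_id_eq_zero]; ext, fun _ => by simp⟩

end OpenStabilizers

/-- The category of `k`-linear `Γ`-modules with open stabilizers. -/
abbrev DiscRep (k : Type v) [CommRing k] (Γ : Type u) [Group Γ] [TopologicalSpace Γ] :=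
  (openStabilizers k Γ).FullSubcategory

namespace DiscRep

section Hom

variable {k : Type v} [CommRing k] {Γ : Type u} [Group Γ] [TopologicalSpace Γ]

/-- The module underlying a discrete representation. -/
abbrev V (M : DiscRep k Γ) : Type u := M.obj.V

/-- The action of the group on a discrete representation. -/
abbrev ρ (M : DiscRep k Γ) : Representation k Γ M.V := M.obj.ρ

/-- The linear map underlying a morphism of discrete representations. -/
def toLinearMap {M N : DiscRep k Γ} (f : M ⟶ N) : M.V →ₗ[k] N.V := f.hom.hom.toLinearMap

/-- The morphism of discrete representations given by an equivariant linear map. -/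
def ofLinearMap {M N : DiscRep k Γ} (f : M.V →ₗ[k] N.V) (hf : ∀ g m, f (M.ρ g m) = N.ρ g (f m)) :
    M ⟶ N :=
  ObjectProperty.homMk (Rep.ofHom ⟨f, fun g => LinearMap.ext (hf g)⟩)

lemma isLocallyConstant_ρ [ContinuousMul Γ] (M : DiscRep k Γ) (m : M.V) :
    IsLocallyConstant fun g => M.ρ g m :=
  (isOpen_stabilizer_iff_isLocallyConstant M.ρ m).1 (M.property m)

lemma toLinearMap_ρ {M N : DiscRep k Γ} (f : M ⟶ N) (g : Γ) (m : M.V) :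
    toLinearMap f (M.ρ g m) = N.ρ g (toLinearMap f m) :=
  Rep.hom_comm_apply f.hom g m

@[ext]
lemma hom_ext {M N : DiscRep k Γ} {f g : M ⟶ N} (h : ∀ m, toLinearMap f m = toLinearMap g m) :
    f = g := by
  apply ObjectProperty.hom_ext
  apply Rep.hom_ext
  ext m
  exact h m

@[simp]
lemma toLinearMap_ofLinearMap {M N : DiscRep k Γ} (f : M.V →ₗ[k] N.V)
    (hf : ∀ g m, f (M.ρ g m) = N.ρ g (f m)) : toLinearMap (ofLinearMap f hf) = f := rfl

@[simp]
lemma toLinearMap_comp {M N P : DiscRep k Γ} (f : M ⟶ N) (g : N ⟶ P) :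
    toLinearMap (f ≫ g) = toLinearMap g ∘ₗ toLinearMap f := rfl

@[simp]
lemma toLinearMap_zero {M N : DiscRep k Γ} : toLinearMap (0 : M ⟶ N) = 0 := rfl

end Hom

section Exactness

variable {k : Type v} [CommRing k] {Γ : Type u} [Group Γ] [TopologicalSpace Γ] [ContinuousMul Γ]

instance : PreservesFiniteLimits
    ((openStabilizers k Γ).ι ⋙ forget₂ (Rep.{u} k Γ) (ModuleCat.{u} k)) :=
  have := preservesFiniteLimits_fullSubcategory_ι (openStabilizers k Γ)
  inferInstance

instance : PreservesFiniteColimits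
    ((openStabilizers k Γ).ι ⋙ forget₂ (Rep.{u} k Γ) (ModuleCat.{u} k)) :=
  have := preservesFiniteColimits_fullSubcategory_ι (openStabilizers k Γ)
  inferInstance

lemma exact_iff (S : ShortComplex (DiscRep k Γ)) :
    S.Exact ↔ ∀ x, toLinearMap S.g x = 0 → ∃ y, toLinearMap S.f y = x := by
  rw [← S.exact_map_iff_of_faithful
    ((openStabilizers k Γ).ι ⋙ forget₂ (Rep.{u} k Γ) (ModuleCat.{u} k)),
    ShortComplex.moduleCat_exact_iff]
  rfl

lemma mono_iff {M N : DiscRep k Γ} (f : M ⟶ N) : Mono f ↔ Function.Injective (toLinearMap f) := by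
  rw [← ((openStabilizers k Γ).ι ⋙ forget₂ (Rep.{u} k Γ) (ModuleCat.{u} k)).mono_map_iff_mono,
    ModuleCat.mono_iff_injective]
  rfl

lemma epi_iff {M N : DiscRep k Γ} (f : M ⟶ N) : Epi f ↔ Function.Surjective (toLinearMap f) := by
  rw [← ((openStabilizers k Γ).ι ⋙ forget₂ (Rep.{u} k Γ) (ModuleCat.{u} k)).epi_map_iff_epi,
    ModuleCat.epi_iff_surjective]
  rfl

lemma shortExact_iff (S : ShortComplex (DiscRep k Γ)) :
    S.ShortExact ↔ Function.Injective (toLinearMap S.f) ∧ Function.Surjective (toLinearMap S.g) ∧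
      ∀ x, toLinearMap S.g x = 0 → ∃ y, toLinearMap S.f y = x := by
  rw [← mono_iff, ← epi_iff, ← exact_iff]
  exact ⟨fun h => ⟨h.mono_f, h.epi_g, h.exact⟩, fun ⟨_, _, h⟩ => ⟨h⟩⟩

end Exactness

end DiscRep

section DiscreteTopReps

variable {k : Type v} [CommRing k] [TopologicalSpace k] {Γ : Type u} [Group Γ]
  [TopologicalSpace Γ]

/-- A topological representation is discrete if its topology is discrete and it has open
stabilizers. -/
class IsDiscreteTopRep (T : TopRep.{u} k Γ) : Prop where
  discreteTopology : DiscreteTopology T.V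
  isOpen_stabilizer : ∀ m : T.V, IsOpen {g : Γ | T.ρ g m = m}

attribute [instance] IsDiscreteTopRep.discreteTopology

namespace DiscRep

/-- The discrete representation underlying a discrete topological representation. -/
abbrev ofTopRep (T : TopRep.{u} k Γ) [IsDiscreteTopRep T] : DiscRep k Γ :=
  ⟨Rep.of T.ρ.toRepresentation, IsDiscreteTopRep.isOpen_stabilizer⟩

/-- The morphism of discrete representations underlying a morphism of topological
representations. -/
def ofTopRepMap {T T' : TopRep.{u} k Γ} [IsDiscreteTopRep T] [IsDiscreteTopRep T'] (f : T ⟶ T') :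
    ofTopRep T ⟶ ofTopRep T' :=
  ObjectProperty.homMk (Rep.ofHom f.hom.toIntertwiningMap)

/-- A discrete representation, endowed with the discrete topology. -/
def toTopRep [DiscreteTopology k] (M : DiscRep k Γ) : TopRep.{u} k Γ :=
  letI : TopologicalSpace M.V := ⊥
  letI : DiscreteTopology M.V := ⟨rfl⟩
  letI : ContinuousSMul k M.V := ⟨continuous_of_discreteTopology⟩
  TopRep.of (ContRepresentation.ofMonoidHom
    { toFun := fun g => ⟨M.ρ g, continuous_of_discreteTopology⟩
      map_one' := by ext; simp
      map_mul' := fun _ _ => by ext; simp })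

instance [DiscreteTopology k] (M : DiscRep k Γ) : IsDiscreteTopRep M.toTopRep where
  discreteTopology := ⟨rfl⟩
  isOpen_stabilizer := M.property

end DiscRep

lemma continuous_topRep_action [ContinuousMul Γ] (T : TopRep.{u} k Γ) [IsDiscreteTopRep T] :
    Continuous fun p : Γ × T.V => T.ρ p.1 p.2 :=
  continuous_prod_of_discrete_right.2 fun t =>
    ((DiscRep.ofTopRep T).isLocallyConstant_ρ t).continuous

lemma discreteTopology_continuousMap (X Y : Type*) [TopologicalSpace X] [CompactSpace X]
    [TopologicalSpace Y] [DiscreteTopology Y] : DiscreteTopology C(X, Y) := by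
  refine discreteTopology_iff_isOpen_singleton.2 fun f => ?_
  have hfin : (Set.range f).Finite := (isCompact_range f.continuous).finite_of_discrete
  have : {f} = ⋂ y ∈ Set.range f, {h : C(X, Y) | Set.MapsTo h (f ⁻¹' {y}) {y}} := by
    ext h
    simp only [Set.mem_singleton_iff, ContinuousMap.ext_iff, Set.mem_iInter, Set.forall_mem_range,
      Set.mem_ofPred_eq, Set.MapsTo, Set.mem_preimage]
    exact ⟨fun hf x y hxy => (hf y).trans hxy, fun hf x => hf x rfl⟩
  rw [this]
  exact hfin.isOpen_biInter fun y _ => ContinuousMap.isOpen_setOfPred_mapsTo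
    ((isClosed_discrete {y}).preimage f.continuous).isCompact (isOpen_discrete {y})

variable [IsTopologicalGroup Γ] [CompactSpace Γ]

instance (T : TopRep.{u} k Γ) [IsDiscreteTopRep T] : IsDiscreteTopRep T.coind₁ where
  discreteTopology := discreteTopology_continuousMap Γ T.V
  isOpen_stabilizer f := by
    have := discreteTopology_continuousMap Γ T.V
    let f' : C(Γ, T.V) := f
    have hcont : Continuous fun g => T.ρ.coind₁ g f' :=
      ContinuousMap.continuous_of_continuous_uncurry _ <| (continuous_topRep_action T).comp <|
        continuous_fst.prodMk (f'.continuous.comp (by fun_prop : Continuous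
          fun p : Γ × Γ => p.1⁻¹ * p.2))
    exact (isOpen_discrete {f'}).preimage hcont

instance (T : TopRep.{u} k Γ) [IsDiscreteTopRep T] (n : ℕ) :
    IsDiscreteTopRep (T.resolutionX n) := by
  induction n with
  | zero => assumption
  | succ n ih => exact inferInstanceAs (IsDiscreteTopRep (T.resolutionX n).coind₁)

end DiscreteTopReps

namespace DiscRep

section Coinduction

variable {k : Type v} [CommRing k] [TopologicalSpace k] {Γ : Type u} [Group Γ]
  [TopologicalSpace Γ] [IsTopologicalGroup Γ] [CompactSpace Γ]
  (N : DiscRep k Γ) (T T' T'' : TopRep.{u} k Γ) [IsDiscreteTopRep T] [IsDiscreteTopRep T']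
  [IsDiscreteTopRep T'']

/-- The coinduced representation `C(Γ, T)` of a discrete representation `T`. -/
abbrev coind : DiscRep k Γ := ofTopRep T.coind₁

/-- The linear isomorphism which turns the action on a coinduced representation into left
translation: it sends a function `c` to `x ↦ x⁻¹ • c x`. -/
def coindEquiv : (coind T).V ≃ₗ[k] C(Γ, T.V) where
  toFun c := ⟨fun x => T.ρ x⁻¹ ((show C(Γ, T.V) from c) x), (continuous_topRep_action T).comp
    (continuous_inv.prodMk (show C(Γ, T.V) from c).continuous)⟩
  invFun c := (⟨fun x => T.ρ x (c x), (continuous_topRep_action T).comp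
    (continuous_id.prodMk c.continuous)⟩ : C(Γ, T.V))
  map_add' _ _ := ContinuousMap.ext fun x => map_add (T.ρ x⁻¹) _ _
  map_smul' _ _ := ContinuousMap.ext fun x => map_smul (T.ρ x⁻¹) _ _
  left_inv _ := ContinuousMap.ext fun x => T.ρ.toRepresentation.self_inv_apply x _
  right_inv _ := ContinuousMap.ext fun x => T.ρ.toRepresentation.inv_self_apply x _

variable {T T' T''}

lemma coindEquiv_ρ (g : Γ) (c : (coind T).V) (x : Γ) :
    coindEquiv T ((coind T).ρ g c) x = coindEquiv T c (g⁻¹ * x) := by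
  have : T.ρ x⁻¹ * T.ρ g = T.ρ (g⁻¹ * x)⁻¹ := by rw [← map_mul, mul_inv_rev, inv_inv]
  exact congr($this ((show C(Γ, T.V) from c) (g⁻¹ * x)))

variable (T) in
/-- The evaluation map of a coinduced representation, the counit of Frobenius reciprocity. -/
def coindEval : (coind T).V →ₗ[k] T.V where
  toFun c := coindEquiv T c 1
  map_add' _ _ := by simp
  map_smul' _ _ := by simp

lemma coindEval_apply (c : (coind T).V) : coindEval T c = coindEquiv T c 1 := rfl

lemma coindEquiv_toLinearMap {N : DiscRep k Γ} (φ : N ⟶ coind T) (n : N.V) (x : Γ) :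
    coindEquiv T (toLinearMap φ n) x = coindEval T (toLinearMap φ (N.ρ x⁻¹ n)) := by
  rw [coindEval_apply, toLinearMap_ρ, coindEquiv_ρ, inv_inv, mul_one]

lemma coind_hom_ext {N : DiscRep k Γ} {φ φ' : N ⟶ coind T}
    (h : ∀ n, coindEval T (toLinearMap φ n) = coindEval T (toLinearMap φ' n)) : φ = φ' :=
  hom_ext fun n => (coindEquiv T).injective <| ContinuousMap.ext fun x => by
    rw [coindEquiv_toLinearMap φ, coindEquiv_toLinearMap φ', h]

/-- The morphism to a coinduced representation attached by Frobenius reciprocity to a linear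
map. -/
def coindLift (ψ : N.V →ₗ[k] T.V) : N ⟶ coind T :=
  ofLinearMap
    ((coindEquiv T).symm.toLinearMap ∘ₗ
      { toFun := fun n => ⟨fun x => ψ (N.ρ x⁻¹ n),
          (((N.isLocallyConstant_ρ n).comp ψ).continuous.comp continuous_inv)⟩
        map_add' := fun _ _ => by ext; simp
        map_smul' := fun _ _ => by ext; simp })
    fun g n => (coindEquiv T).injective <| ContinuousMap.ext fun x => by
      rw [coindEquiv_ρ]
      simp [← Module.End.mul_apply, ← map_mul]

variable {N}

@[simp]
lemma coindEquiv_coindLift (ψ : N.V →ₗ[k] T.V) (n : N.V) (x : Γ) :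
    coindEquiv T (toLinearMap (coindLift N ψ) n) x = ψ (N.ρ x⁻¹ n) := by
  simp [coindLift]

@[simp]
lemma coindEval_coindLift (ψ : N.V →ₗ[k] T.V) (n : N.V) :
    coindEval T (toLinearMap (coindLift N ψ) n) = ψ n := by
  simp [coindEval_apply]

lemma coindLift_injective {ψ : N.V →ₗ[k] T.V} (hψ : Function.Injective ψ) :
    Function.Injective (toLinearMap (coindLift N ψ)) := fun a b h => hψ <| by
  simpa using congr(coindEval T $h)

lemma injective_coind [hT : Module.Injective k T.V] : Injective (coind T) where
  factors {M N} g i _ := by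
    obtain ⟨ψ, hψ⟩ := hT.out (toLinearMap i) ((mono_iff i).1 inferInstance)
      (coindEval T ∘ₗ toLinearMap g)
    exact ⟨coindLift N ψ, coind_hom_ext fun m => by simpa using hψ m⟩

/-- The map between coinduced representations attached to a linear map, which need not be
equivariant: coinduction depends only on the underlying module. -/
def coindMap (f : T.V →ₗ[k] T'.V) : coind T ⟶ coind T' :=
  coindLift (coind T) (f ∘ₗ coindEval T)

@[simp]
lemma coindEquiv_coindMap (f : T.V →ₗ[k] T'.V) (c : (coind T).V) (x : Γ) :
    coindEquiv T' (toLinearMap (coindMap f) c) x = f (coindEquiv T c x) := by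
  rw [coindMap, coindEquiv_coindLift, LinearMap.comp_apply, coindEval_apply, coindEquiv_ρ, inv_inv,
    mul_one]

lemma exists_shortExact_coindMap {f : T.V →ₗ[k] T'.V} {f' : T'.V →ₗ[k] T''.V}
    (hinj : Function.Injective f) (hsurj : Function.Surjective f') (hex : Function.Exact f f') :
    ∃ w : coindMap f ≫ coindMap f' = 0, (ShortComplex.mk _ _ w).ShortExact := by
  refine ⟨hom_ext fun c => (coindEquiv T'').injective <| ContinuousMap.ext fun x => ?_,
    (shortExact_iff _).2 ⟨fun a b h => (coindEquiv T).injective <| ContinuousMap.ext fun x =>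
      hinj ?_, fun c => ?_, fun c hc => ?_⟩⟩
  · simpa using hex.apply_apply_eq_zero _
  · simpa using congr(coindEquiv T' $h x)
  · let s : C(T''.V, T'.V) := ⟨Function.surjInv hsurj, continuous_of_discreteTopology⟩
    refine ⟨(coindEquiv T').symm (s.comp (coindEquiv T'' c)),
      (coindEquiv T'').injective <| ContinuousMap.ext fun x => ?_⟩
    simp [s, Function.surjInv_eq hsurj]
  · let s : C(T'.V, T.V) := ⟨Function.invFun f, continuous_of_discreteTopology⟩
    refine ⟨(coindEquiv T).symm (s.comp (coindEquiv T' c)),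
      (coindEquiv T').injective <| ContinuousMap.ext fun x => ?_⟩
    have : f' (coindEquiv T' c x) = 0 := by simpa using congr(coindEquiv T'' $hc x)
    simpa [s] using Function.invFun_eq ((hex _).1 this)

end Coinduction

section Acyclicity

universe w

variable {k : Type v} [CommRing k] {Γ : Type u} [Group Γ] [TopologicalSpace Γ]

/-- The discrete representation with trivial action on a module. -/
abbrev trivial (k : Type v) [CommRing k] (Γ : Type u) [Group Γ] [TopologicalSpace Γ] (A : Type u)
    [AddCommGroup A] [Module k A] : DiscRep k Γ :=
  ⟨Rep.trivial k Γ A, fun m => by simp⟩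

variable [TopologicalSpace k] [IsTopologicalGroup Γ] [CompactSpace Γ]

lemma exists_lift_coind_of_projective (X : DiscRep k Γ) [Module.Projective k X.V]
    {T T' : TopRep.{u} k Γ} [IsDiscreteTopRep T] [IsDiscreteTopRep T'] {f : T.V →ₗ[k] T'.V}
    (hf : Function.Surjective f) (φ : X ⟶ coind T') : ∃ φ' : X ⟶ coind T, φ' ≫ coindMap f = φ := by
  obtain ⟨ψ, hψ⟩ := Module.projective_lifting_property f (coindEval T' ∘ₗ toLinearMap φ) hf
  refine ⟨coindLift X ψ, coind_hom_ext fun n => ?_⟩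
  simpa [coindEval_apply _] using congr($hψ n)

variable [DiscreteTopology k]

lemma exists_shortExact_coind_injective [Small.{u} k] (T : TopRep.{u} k Γ) [IsDiscreteTopRep T] :
    ∃ (E Q : TopRep.{u} k Γ) (_ : IsDiscreteTopRep E) (_ : IsDiscreteTopRep Q) (i : T.V →ₗ[k] E.V)
      (p : E.V →ₗ[k] Q.V), Injective (coind E) ∧ Function.Injective i ∧ Function.Surjective p ∧
        Function.Exact i p := by
  let I := Injective.under (ModuleCat.of k T.V)
  let i : T.V →ₗ[k] I := (Injective.ι (ModuleCat.of k T.V)).hom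
  let E := (trivial k Γ I).toTopRep
  have : Module.Injective k E.V :=
    have : Injective (ModuleCat.of k I) := inferInstanceAs (Injective I)
    Module.injective_module_of_injective_object k I
  exact ⟨E, (trivial k Γ (I ⧸ LinearMap.range i)).toTopRep, inferInstance, inferInstance, i,
    (show I →ₗ[k] I ⧸ LinearMap.range i from (LinearMap.range i).mkQ), injective_coind (T := E),
    (ModuleCat.mono_iff_injective (Injective.ι (ModuleCat.of k T.V))).1 inferInstance,
    (LinearMap.range i).mkQ_surjective, LinearMap.exact_map_mkQ_range i⟩

/-- Since coinduction only depends on the underlying module and is exact, an embedding of `T` into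
an injective module shifts the degree. -/
lemma subsingleton_ext_coind_of_projective [Small.{u} k] [HasExt.{w} (DiscRep k Γ)]
    (X : DiscRep k Γ) [Module.Projective k X.V] (T : TopRep.{u} k Γ) [IsDiscreteTopRep T] (n : ℕ) :
    Subsingleton (Ext X (coind T) (n + 1)) := by
  induction n generalizing T with
  | zero =>
    obtain ⟨E, Q, _, _, i, p, _, hi, hp, hex⟩ := exists_shortExact_coind_injective T
    obtain ⟨w, hS⟩ := exists_shortExact_coindMap hi hp hex
    exact subsingleton_ext_one_of_exists_lift hS X (Ext.subsingleton_of_injective _ _ _)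
      (exists_lift_coind_of_projective X hp)
  | succ n ih =>
    obtain ⟨E, Q, _, _, i, p, _, hi, hp, hex⟩ := exists_shortExact_coind_injective T
    obtain ⟨w, hS⟩ := exists_shortExact_coindMap hi hp hex
    exact subsingleton_ext_X₁_of_shortExact hS X (ih Q) (Ext.subsingleton_of_injective _ _ _)

end Acyclicity

end DiscRep

section DivisibleAndPrimaryGroups

/-- An abelian group is divisible if multiplication by every nonzero natural number is
surjective. -/
def IsDivisible (A : Type*) [AddCommGroup A] : Prop := ∀ n : ℕ, n ≠ 0 → ∀ a : A, ∃ b : A, n • b = a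

/-- An abelian group is `ℓ`-primary if every element is killed by a power of `ℓ`. -/
def IsPrimary (ℓ : ℕ) (A : Type*) [AddCommGroup A] : Prop := ∀ a : A, ∃ n : ℕ, ℓ ^ n • a = 0

lemma pow_smul_eq_zero_of_le {A : Type*} [AddMonoid A] {ℓ m n : ℕ} {a : A} (h : ℓ ^ m • a = 0)
    (hmn : m ≤ n) : ℓ ^ n • a = 0 := by
  obtain ⟨c, rfl⟩ := Nat.exists_eq_add_of_le' hmn
  rw [pow_add, mul_nsmul', h, nsmul_zero]

variable {A B : Type*} [AddCommGroup A] [AddCommGroup B] {ℓ : ℕ}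

lemma isDivisible_iff_module_injective [Module ℤ A] : IsDivisible A ↔ Module.Injective ℤ A := by
  obtain rfl : ‹Module ℤ A› = AddCommGroup.toIntModule A := Subsingleton.elim _ _
  refine ⟨fun hA => ?_, fun hA n hn a => ?_⟩
  · let : DivisibleBy A ℕ := divisibleByOfSMulRightSurj A ℕ fun {n} hn a => hA n hn a
    let : DivisibleBy A ℤ := AddGroup.divisibleByIntOfDivisibleByNat A
    exact (Module.Baer.of_divisible A).injective
  · obtain ⟨h, hh⟩ := (Module.Baer.of_injective hA).extension_property
      (LinearMap.lsmul ℤ ℤ n) (mul_right_injective₀ (Nat.cast_ne_zero.2 hn))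
      (LinearMap.toSpanSingleton ℤ A a)
    exact ⟨h 1, by rw [← map_nsmul]; simpa using congr($hh 1)⟩

lemma IsDivisible.of_surjective (hA : IsDivisible A) (f : A →+ B) (hf : Function.Surjective f) :
    IsDivisible B := fun n hn b => by
  obtain ⟨a, rfl⟩ := hf b
  obtain ⟨c, rfl⟩ := hA n hn a
  exact ⟨f c, (map_nsmul f n c).symm⟩

lemma IsPrimary.of_surjective (hA : IsPrimary ℓ A) (f : A →+ B) (hf : Function.Surjective f) :
    IsPrimary ℓ B := fun b => by
  obtain ⟨a, rfl⟩ := hf b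
  obtain ⟨n, hn⟩ := hA a
  exact ⟨n, by rw [← map_nsmul, hn, map_zero]⟩

lemma IsPrimary.of_injective (hB : IsPrimary ℓ B) (f : A →+ B) (hf : Function.Injective f) :
    IsPrimary ℓ A := fun a => by
  obtain ⟨n, hn⟩ := hB (f a)
  exact ⟨n, hf (by rw [map_nsmul, hn, map_zero])⟩

lemma IsPrimary.exists_pow_of_finite (hA : IsPrimary ℓ A) {s : Set A} (hs : s.Finite) :
    ∃ n : ℕ, ∀ a ∈ s, ℓ ^ n • a = 0 := by
  choose f hf using hA
  obtain ⟨n, hn⟩ := (hs.image f).bddAbove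
  exact ⟨n, fun a ha => pow_smul_eq_zero_of_le (hf a) (hn ⟨a, ha, rfl⟩)⟩

lemma isPrimary_torsion'_powers (ℓ : ℕ) (A : Type*) [AddCommGroup A] [Module ℤ A] :
    IsPrimary ℓ (Submodule.torsion' ℤ A (Submonoid.powers ℓ)) := by
  rintro ⟨a, ⟨_, n, rfl⟩, hn⟩
  exact ⟨n, Subtype.ext hn⟩

lemma IsDivisible.exists_prime_smul_eq (hA : IsDivisible A) {p : ℕ} (hp : p.Prime) {k : ℕ} {a : A}
    (ha : ℓ ^ k • a = 0) : ∃ b : A, p • b = a ∧ ∃ n : ℕ, ℓ ^ n • b = 0 := by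
  by_cases hpℓ : p ∣ ℓ
  · obtain ⟨q, rfl⟩ := hpℓ
    obtain ⟨b, rfl⟩ := hA p hp.ne_zero a
    refine ⟨b, rfl, k + 1, ?_⟩
    rw [show (p * q) ^ (k + 1) = q * ((p * q) ^ k * p) by ring, mul_smul, mul_smul, ha, smul_zero]
  · obtain ⟨u, v, huv⟩ := Nat.isCoprime_iff_coprime.2
      (((Nat.Prime.coprime_iff_not_dvd hp).2 hpℓ).pow_right k)
    refine ⟨u • a, ?_, k, by rw [smul_comm, ha, smul_zero]⟩
    calc p • u • a = (u * (p : ℤ)) • a + v • ((ℓ ^ k : ℕ) : ℤ) • a := by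
          rw [natCast_zsmul, ha, smul_zero, add_zero, mul_smul, natCast_zsmul, smul_comm]
      _ = a := by rw [← mul_smul, ← add_smul, huv, one_smul]

lemma IsDivisible.torsion'_powers [Module ℤ A] (hA : IsDivisible A) (ℓ : ℕ) :
    IsDivisible (Submodule.torsion' ℤ A (Submonoid.powers ℓ)) := by
  intro n
  induction n using induction_on_primes with
  | zero => exact fun h => (h rfl).elim
  | one => exact fun _ a => ⟨a, one_nsmul a⟩
  | prime_mul p n hp ih =>
    rintro hpn a
    obtain ⟨⟨b, ⟨_, k, rfl⟩, hb⟩, rfl⟩ := ih (right_ne_zero_of_mul hpn) a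
    obtain ⟨c, rfl, m, hm⟩ := hA.exists_prime_smul_eq hp hb
    exact ⟨⟨c, ⟨_, m, rfl⟩, hm⟩, Subtype.ext (by simp [mul_comm p n, mul_smul])⟩

lemma exists_injective_isDivisible_isPrimary {A : Type u} [AddCommGroup A] [Module ℤ A]
    (hA : IsPrimary ℓ A) : ∃ (E : Type u) (_ : AddCommGroup E) (_ : Module ℤ E) (i : A →ₗ[ℤ] E),
      Function.Injective i ∧ IsDivisible E ∧ IsPrimary ℓ E := by
  let I := Injective.under (ModuleCat.of ℤ A)
  let i : A →ₗ[ℤ] I := (Injective.ι (ModuleCat.of ℤ A)).hom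
  have hi : Function.Injective i :=
    (ModuleCat.mono_iff_injective (Injective.ι (ModuleCat.of ℤ A))).1 inferInstance
  have : Injective (ModuleCat.of ℤ I) := inferInstanceAs (Injective I)
  refine ⟨Submodule.torsion' ℤ I (Submonoid.powers ℓ), _, _,
    i.codRestrict _ fun a => ?_, (LinearMap.injective_codRestrict_iff _).2 hi,
    (isDivisible_iff_module_injective.2
      (Module.injective_module_of_injective_object ℤ I)).torsion'_powers ℓ,
    isPrimary_torsion'_powers ℓ I⟩
  obtain ⟨n, hn⟩ := hA a
  exact ⟨⟨_, n, rfl⟩, (map_nsmul i _ a).symm.trans (by rw [hn, map_zero])⟩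

end DivisibleAndPrimaryGroups

/-- The category of discrete `Γ`-modules. -/
abbrev DiscMod (Γ : Type u) [Group Γ] [TopologicalSpace Γ] := DiscRep ℤ Γ

namespace DiscMod

open DiscRep (coind coindEquiv coindLift toLinearMap)

/-- The `ℤ`-module structure carried by a representation is only propositionally that of
`AddCommGroup.toIntModule`; this instance, having `ℤ` in its head, takes precedence over it. -/
instance instModuleInt {G : Type*} [Monoid G] (M : Rep ℤ G) : Module ℤ M.V := M.hV2

variable {Γ : Type u} [Group Γ] [TopologicalSpace Γ] [IsTopologicalGroup Γ] [CompactSpace Γ]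

section Coind

variable {ℓ : ℕ} (T : TopRep.{u} ℤ Γ) [IsDiscreteTopRep T]

lemma isDivisible_coind (hT : IsDivisible T.V) : IsDivisible (coind T).V := fun n hn f => by
  choose s hs using hT n hn
  refine ⟨(coindEquiv T).symm ((⟨s, continuous_of_discreteTopology⟩ : C(T.V, T.V)).comp
    (coindEquiv T f)), (coindEquiv T).injective <| ContinuousMap.ext fun x => ?_⟩
  simp [hs]

lemma isPrimary_coind (hT : IsPrimary ℓ T.V) : IsPrimary ℓ (coind T).V := fun f => by
  obtain ⟨n, hn⟩ := hT.exists_pow_of_finite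
    (isCompact_range (coindEquiv T f).continuous).finite_of_discrete
  refine ⟨n, (coindEquiv T).injective <| ContinuousMap.ext fun x => ?_⟩
  simpa using hn _ ⟨x, rfl⟩

end Coind

lemma injective_coind_of_isDivisible (T : TopRep.{u} ℤ Γ) [IsDiscreteTopRep T]
    (hT : IsDivisible T.V) : Injective (coind T) :=
  DiscRep.injective_coind (hT := let := T.hV2; isDivisible_iff_module_injective.1 hT)

lemma exists_shortExact_injective_of_isPrimary {ℓ : ℕ} (M : DiscMod Γ) (hM : IsPrimary ℓ M.V) :
    ∃ (J Q : DiscMod Γ) (i : M ⟶ J) (p : J ⟶ Q) (w : i ≫ p = 0),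
      (ShortComplex.mk i p w).ShortExact ∧ Injective J ∧ IsDivisible J.V ∧ IsPrimary ℓ J.V ∧
        IsDivisible Q.V ∧ IsPrimary ℓ Q.V := by
  obtain ⟨E, _, _, i, hi, hd, hp⟩ := exists_injective_isDivisible_isPrimary hM
  let T := (DiscRep.trivial ℤ Γ E).toTopRep
  let j : M ⟶ coind T := coindLift M i
  have : Mono j := (DiscRep.mono_iff j).2 (DiscRep.coindLift_injective hi)
  have hπ : Function.Surjective (toLinearMap (cokernel.π j)) :=
    (DiscRep.epi_iff _).1 inferInstance
  exact ⟨coind T, cokernel j, j, cokernel.π j, cokernel.condition j,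
    { exact := ShortComplex.exact_cokernel j }, injective_coind_of_isDivisible T hd,
    isDivisible_coind T hd, isPrimary_coind T hp,
    (isDivisible_coind T hd).of_surjective (toLinearMap (cokernel.π j)).toAddMonoidHom hπ,
    (isPrimary_coind T hp).of_surjective (toLinearMap (cokernel.π j)).toAddMonoidHom hπ⟩

end DiscMod

section Retract

universe w

lemma subsingleton_ext_of_retract {C : Type u} [Category.{v} C] [Abelian C] [HasExt.{w} C]
    {Y Z : C} (r : Retract Y Z) (L : C) {n : ℕ} (h : Subsingleton (Ext L Z n)) :
    Subsingleton (Ext L Y n) :=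
  subsingleton_of_forall_eq 0 fun e => by
    rw [← e.comp_mk₀_id, ← r.retract, ← Ext.mk₀_comp_mk₀, ← Ext.comp_assoc_of_third_deg_zero,
      Subsingleton.elim (e.comp (Ext.mk₀ r.i) (add_zero n)) 0, Ext.zero_comp]

end Retract

namespace DiscRep

section InternalHom

universe w

variable {k : Type v} [CommRing k] {Γ : Type u} [Group Γ] [TopologicalSpace Γ]
  [IsTopologicalGroup Γ] (X : DiscRep k Γ) [Module.Finite k X.V]

lemma isOpen_stabilizer_linHom (N : DiscRep k Γ) (f : X.V →ₗ[k] N.V) :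
    IsOpen {g : Γ | Representation.linHom X.ρ N.ρ g f = f} := by
  obtain ⟨s, hs⟩ := ‹Module.Finite k X.V›.fg_top
  have : {g : Γ | Representation.linHom X.ρ N.ρ g f = f} =
      ⋂ x ∈ s, {g : Γ | N.ρ g (f (X.ρ g⁻¹ x)) = f x} := by
    ext g
    simp only [Set.mem_iInter]
    exact ⟨fun h x _ => congr($h x), fun h => LinearMap.ext_on hs fun x hx => h x hx⟩
  rw [this]
  refine isOpen_biInter_finset fun x _ => ?_
  let : TopologicalSpace N.V := ⊥
  have : DiscreteTopology N.V := ⟨rfl⟩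
  have haction : Continuous fun p : Γ × N.V => N.ρ p.1 p.2 :=
    continuous_prod_of_discrete_right.2 fun m => (N.isLocallyConstant_ρ m).continuous
  have hcont : Continuous fun g => N.ρ g (f (X.ρ g⁻¹ x)) :=
    haction.comp (continuous_id.prodMk
      (((X.isLocallyConstant_ρ x).comp f).continuous.comp continuous_inv))
  exact (isOpen_discrete {f x}).preimage hcont

/-- The internal `Hom` out of a discrete representation `X` with finitely generated underlying
module: the group acts by conjugation on the module of linear maps. -/
def ihom : DiscRep k Γ ⥤ DiscRep k Γ where
  obj N := ⟨Rep.of (Representation.linHom X.ρ N.ρ), isOpen_stabilizer_linHom X N⟩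
  map p := ofLinearMap (LinearMap.compRight k (toLinearMap p)) fun g f =>
    LinearMap.ext fun x => toLinearMap_ρ p g _

instance : (ihom X).PreservesZeroMorphisms where
  map_zero _ _ := hom_ext fun _ => rfl

variable {X} {N N' : DiscRep k Γ}

/-- The elements of the internal `Hom` are the linear maps. -/
def ihomEquiv : ((ihom X).obj N).V ≃ₗ[k] (X.V →ₗ[k] N.V) := LinearEquiv.refl k _

lemma ihomEquiv_ρ (g : Γ) (f : ((ihom X).obj N).V) (x : X.V) :
    ihomEquiv (((ihom X).obj N).ρ g f) x = N.ρ g (ihomEquiv f (X.ρ g⁻¹ x)) := rfl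

variable (X) in
lemma shortExact_map_ihom {S : ShortComplex (DiscRep k Γ)} (hS : S.ShortExact)
    [hS₁ : Module.Injective k S.X₁.V] : (S.map (ihom X)).ShortExact := by
  obtain ⟨hi, hp, hex⟩ := (shortExact_iff S).1 hS
  have hker : Function.Exact (toLinearMap S.f) (toLinearMap S.g) := fun x =>
    ⟨hex x, by rintro ⟨y, rfl⟩; exact congr(toLinearMap $S.zero y)⟩
  obtain ⟨r, hr⟩ := hS₁.out (toLinearMap S.f) hi LinearMap.id
  obtain ⟨-, s, hs⟩ := (hker.split_tfae'.out 1 0 :).1 ⟨hp, r, LinearMap.ext hr⟩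
  refine (shortExact_iff _).2 ⟨fun f f' h => ihomEquiv.injective <| LinearMap.ext fun x => hi ?_,
    fun f => ⟨ihomEquiv.symm (s ∘ₗ ihomEquiv f), ihomEquiv.injective ?_⟩, fun f hf => ?_⟩
  · exact congr(ihomEquiv $h x)
  · exact (LinearMap.comp_assoc _ _ _).symm.trans congr($hs ∘ₗ ihomEquiv f)
  · have hrange (x : X.V) : ihomEquiv f x ∈ LinearMap.range (toLinearMap S.f) :=
      hex _ congr(ihomEquiv $hf x)
    exact ⟨ihomEquiv.symm (LinearMap.codRestrictOfInjective _ _ hi hrange),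
      ihomEquiv.injective (LinearMap.codRestrictOfInjective_comp ..)⟩

section Coind

variable [TopologicalSpace k] [DiscreteTopology k] [CompactSpace Γ]
  (T : TopRep.{u} k Γ) [IsDiscreteTopRep T]

variable (X) in
/-- The comparison from the internal `Hom` into a coinduced representation to the coinduced
representation of the internal `Hom`. -/
def ihomCoind : (ihom X).obj (coind T) ⟶ coind ((ihom X).obj (ofTopRep T)).toTopRep :=
  coindLift _ (show _ →ₗ[k] ((ihom X).obj (ofTopRep T)).V from
    (ihomEquiv (N := ofTopRep T)).symm.toLinearMap ∘ₗ LinearMap.compRight k (coindEval T) ∘ₗ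
      ihomEquiv.toLinearMap)

variable {T}

lemma coindEquiv_ihomCoind (f : ((ihom X).obj (coind T)).V) (y : Γ) (x : X.V) :
    ihomEquiv (N := ofTopRep T) (coindEquiv _ (toLinearMap (ihomCoind X T) f) y) x =
      coindEquiv T (ihomEquiv f (X.ρ y x)) y := by
  refine (congrArg (ihomEquiv (X := X) (N := ofTopRep T) · x) (coindEquiv_coindLift
    (T := ((ihom X).obj (ofTopRep T)).toTopRep) _ f y)).trans ?_
  change coindEval T (ihomEquiv (((ihom X).obj (coind T)).ρ y⁻¹ f) x) = _
  rw [ihomEquiv_ρ, coindEval_apply, coindEquiv_ρ, inv_inv, mul_one]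

instance : IsIso (ihomCoind X T) := by
  have : Mono (ihomCoind X T) := by
    refine (mono_iff _).2 fun f f' h => ihomEquiv.injective <| LinearMap.ext fun x =>
      (coindEquiv T).injective <| ContinuousMap.ext fun y => ?_
    have (f : ((ihom X).obj (coind T)).V) := coindEquiv_ihomCoind f y (X.ρ y⁻¹ x)
    simp only [Representation.self_inv_apply] at this
    rw [← this, ← this, h]
  have : Epi (ihomCoind X T) := by
    refine (epi_iff _).2 fun F => ?_
    let c (y : Γ) : X.V →ₗ[k] T.V := ihomEquiv (N := ofTopRep T) (coindEquiv _ F y)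
    have hc (x : X.V) : Continuous fun y => c y (X.ρ y⁻¹ x) :=
      ((((IsLocallyConstant.iff_continuous _).2 (coindEquiv _ F).continuous).comp
        (ihomEquiv (N := ofTopRep T))).comp₂ ((X.isLocallyConstant_ρ x).comp_continuous
          continuous_inv) fun f x => f x).continuous
    let f : X.V →ₗ[k] C(Γ, T.V) :=
      { toFun := fun x => ⟨fun y => c y (X.ρ y⁻¹ x), hc x⟩
        map_add' := fun _ _ => by ext; simp
        map_smul' := fun _ _ => by ext; simp }
    refine ⟨ihomEquiv.symm ((coindEquiv T).symm.toLinearMap ∘ₗ f), (coindEquiv _).injective <|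
      ContinuousMap.ext fun y => ihomEquiv.injective <| LinearMap.ext fun x => ?_⟩
    refine (coindEquiv_ihomCoind _ y x).trans ?_
    simp [f, c]
  exact isIso_of_mono_of_epi _

variable (X) in
lemma subsingleton_ext_ihom_of_injective [Small.{u} k] [HasExt.{w} (DiscRep k Γ)]
    (P J : DiscRep k Γ) [Module.Projective k P.V] [Injective J] (n : ℕ) :
    Subsingleton (Ext P ((ihom X).obj J) (n + 1)) := by
  let c : J ⟶ coind J.toTopRep := coindLift J LinearMap.id
  have : Mono c := (mono_iff c).2 (coindLift_injective Function.injective_id)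
  let R : Retract ((ihom X).obj J) ((ihom X).obj (coind J.toTopRep)) :=
    Retract.map ⟨c, Injective.factorThru (𝟙 J) c, Injective.comp_factorThru _ _⟩ (ihom X)
  let R' : Retract ((ihom X).obj J) (coind ((ihom X).obj (ofTopRep J.toTopRep)).toTopRep) :=
    R.trans (.ofIso (asIso (ihomCoind X J.toTopRep)))
  exact subsingleton_ext_of_retract R' P (subsingleton_ext_coind_of_projective P _ n)

end Coind

end InternalHom

end DiscRep

namespace DiscMod

open DiscRep (V toLinearMap ofLinearMap toLinearMap_ρ ihom ihomEquiv)

variable {Γ : Type u} [Group Γ] [TopologicalSpace Γ]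

section Unit

/-- The trivial module `ℤ`. -/
abbrev unit (Γ : Type u) [Group Γ] [TopologicalSpace Γ] : DiscMod Γ :=
  DiscRep.trivial ℤ Γ (ULift.{u} ℤ)

/-- The morphisms from the trivial module `ℤ` to a discrete module are the invariant elements. -/
def unitHomEquiv {M : DiscMod Γ} : (unit Γ ⟶ M) ≃ M.ρ.invariants where
  toFun f := ⟨toLinearMap f (⟨1⟩ : ULift ℤ), fun g => (toLinearMap_ρ f g _).symm⟩
  invFun m := ofLinearMap (LinearMap.toSpanSingleton ℤ M.V m ∘ₗ ULift.moduleEquiv.toLinearMap)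
    fun g (n : ULift ℤ) => by simp [(M.ρ.mem_invariants _).1 m.2 g]
  left_inv f := by
    ext (n : ULift ℤ)
    refine (LinearMap.map_smul (toLinearMap f) n.down (⟨1⟩ : ULift ℤ)).symm.trans ?_
    exact congrArg (toLinearMap f) (ULift.ext _ _ (mul_one n.down))
  right_inv m := Subtype.ext (LinearMap.toSpanSingleton_apply_one ℤ _ _)

instance : Module.Projective ℤ (unit Γ).V :=
  .of_equiv (ULift.moduleEquiv (R := ℤ) (M := ℤ)).symm

end Unit

lemma isPrimary_ihom [IsTopologicalGroup Γ] {ℓ : ℕ} {X : DiscMod Γ} [Module.Finite ℤ X.V]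
    (hX : IsPrimary ℓ X.V) (N : DiscMod Γ) : IsPrimary ℓ ((ihom X).obj N).V := fun f => by
  obtain ⟨s, hs⟩ := ‹Module.Finite ℤ X.V›.fg_top
  obtain ⟨n, hn⟩ := hX.exists_pow_of_finite s.finite_toSet
  refine ⟨n, ihomEquiv.injective <| LinearMap.ext_on hs fun x hx => ?_⟩
  simpa [hn x hx] using (map_nsmul (ihomEquiv f) (ℓ ^ n) x).symm

end DiscMod

namespace DiscRep

variable {k : Type v} [CommRing k] {Γ : Type u} [Group Γ] [TopologicalSpace Γ]

lemma exists_module_finite_of_finite [CompactSpace Γ] [ContinuousMul Γ] (M : DiscRep k Γ)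
    {s : Set M.V} (hs : s.Finite) :
    ∃ (W : DiscRep k Γ) (i : W ⟶ M), Function.Injective (toLinearMap i) ∧ Module.Finite k W.V ∧
      s ⊆ Set.range (toLinearMap i) := by
  -- By compactness the orbits are finite.
  let orbits : Set M.V := ⋃ m ∈ s, Set.range fun g => M.ρ g m
  have orbits_finite : orbits.Finite := hs.biUnion fun m _ => (M.isLocallyConstant_ρ m).range_finite
  have mem_orbits {m : M.V} (hm : m ∈ s) (g : Γ) : M.ρ g m ∈ orbits :=
    Set.mem_biUnion hm ⟨g, rfl⟩
  have span_le (g : Γ) : Submodule.span k orbits ≤ (Submodule.span k orbits).comap (M.ρ g) := by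
    refine Submodule.span_le.2 fun x hx => ?_
    obtain ⟨m, hm, h, rfl⟩ := Set.mem_iUnion₂.1 hx
    simpa using Submodule.subset_span (R := k) (mem_orbits hm (g * h))
  let i := M.obj.subtype (Submodule.span k orbits) span_le
  have hi : Function.Injective i.hom := Subtype.val_injective
  have : Mono i := (Rep.mono_iff_injective i).2 hi
  refine ⟨⟨_, (openStabilizers k Γ).prop_of_mono i M.property⟩, ObjectProperty.homMk i, hi,
    .span_of_finite k orbits_finite, fun m hm => ⟨⟨m, Submodule.subset_span ?_⟩, rfl⟩⟩
  simpa using mem_orbits hm 1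

lemma pullback_ext [ContinuousMul Γ] {X Y Z : DiscRep k Γ} (f : X ⟶ Z) (g : Y ⟶ Z)
    (a b : (pullback f g).V)
    (h₁ : toLinearMap (pullback.fst f g) a = toLinearMap (pullback.fst f g) b)
    (h₂ : toLinearMap (pullback.snd f g) a = toLinearMap (pullback.snd f g) b) : a = b := by
  refine Concrete.isLimit_ext _ (isLimitOfPreserves
    ((openStabilizers k Γ).ι ⋙ forget₂ (Rep.{u} k Γ) (ModuleCat.{u} k))
    (pullbackIsPullback f g)) a b ?_
  rintro (_ | _ | _)
  · change toLinearMap (pullback.fst f g ≫ f) a = toLinearMap (pullback.fst f g ≫ f) b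
    exact congrArg (toLinearMap f) h₁
  · exact h₁
  · exact h₂

end DiscRep

section FiniteModules

universe w

namespace DiscMod

open DiscRep (V toLinearMap)

variable {Γ : Type u} [Group Γ] [TopologicalSpace Γ] {ℓ : ℕ}

lemma finite_of_isPrimary [NeZero ℓ] (M : DiscMod Γ) [Module.Finite ℤ M.V]
    (hM : IsPrimary ℓ M.V) : Finite M.V :=
  Module.finite_of_fg_torsion M.V fun {m} => by
    obtain ⟨n, hn⟩ := hM m
    exact ⟨⟨ℓ ^ n, by simp [NeZero.ne ℓ]⟩, by simpa [← Nat.cast_smul_eq_nsmul ℤ] using hn⟩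

variable [IsTopologicalGroup Γ]

lemma isPrimary_pullback {X Y Z : DiscMod Γ} (f : X ⟶ Z) (g : Y ⟶ Z)
    (hX : IsPrimary ℓ X.V) (hY : IsPrimary ℓ Y.V) : IsPrimary ℓ (pullback f g : DiscMod Γ).V :=
  fun a => by
  obtain ⟨m, hm⟩ := hX (toLinearMap (pullback.fst f g) a)
  obtain ⟨n, hn⟩ := hY (toLinearMap (pullback.snd f g) a)
  refine ⟨max m n, DiscRep.pullback_ext f g _ _ ?_ ?_⟩
  · rw [map_nsmul, map_zero, pow_smul_eq_zero_of_le hm (le_max_left m n)]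
  · rw [map_nsmul, map_zero, pow_smul_eq_zero_of_le hn (le_max_right m n)]

variable [CompactSpace Γ] [NeZero ℓ]

lemma exists_finite_epi_comp {E X : DiscMod Γ} (f : E ⟶ X) [Epi f] [Finite X.V]
    (hE : IsPrimary ℓ E.V) :
    ∃ (X' : DiscMod Γ) (i : X' ⟶ E), Finite X'.V ∧ IsPrimary ℓ X'.V ∧ Epi (i ≫ f) := by
  choose s hs using (DiscRep.epi_iff f).1 inferInstance
  obtain ⟨X', i, hi, _, hsi⟩ := DiscRep.exists_module_finite_of_finite E (Set.finite_range s)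
  have hX' : IsPrimary ℓ X'.V := hE.of_injective (toLinearMap i).toAddMonoidHom hi
  refine ⟨X', i, finite_of_isPrimary X' hX', hX', (DiscRep.epi_iff _).2 fun x => ?_⟩
  obtain ⟨y, hy⟩ := hsi ⟨x, rfl⟩
  exact ⟨y, by simp [hy, hs]⟩

lemma exists_finite_epi_mk₀_comp_eq_zero [HasExt.{w} (DiscMod Γ)] {X Q : DiscMod Γ} [Finite X.V]
    (hX : IsPrimary ℓ X.V) (hQ : IsPrimary ℓ Q.V) {n : ℕ} (e : Ext X Q (n + 1)) :
    ∃ (X' : DiscMod Γ) (p : X' ⟶ X), Finite X'.V ∧ IsPrimary ℓ X'.V ∧ Epi p ∧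
      (Ext.mk₀ p).comp e (zero_add _) = 0 := by
  induction n generalizing Q with
  | zero =>
    obtain ⟨J, Q', i, p, w, hS, hJ, -, hJp, -⟩ := exists_shortExact_injective_of_isPrimary Q hQ
    obtain ⟨y, rfl⟩ := Ext.covariant_sequence_exact₁ X hS e
      ((Ext.subsingleton_of_injective _ _ _).elim _ _) rfl
    obtain ⟨f, rfl⟩ := (Ext.mk₀_bijective _ _).2 y
    have := hS.epi_g
    obtain ⟨X', j, hX'f, hX', hj⟩ :=
      exists_finite_epi_comp (pullback.fst f p) (isPrimary_pullback f p hX hJp)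
    refine ⟨X', j ≫ pullback.fst f p, hX'f, hX', hj, ?_⟩
    rw [Ext.mk₀_comp_mk₀_assoc, Category.assoc, pullback.condition, ← Category.assoc,
      ← Ext.mk₀_comp_mk₀_assoc, hS.comp_extClass, Ext.comp_zero]
  | succ n ih =>
    obtain ⟨J, Q', i, p, w, hS, hJ, -, -, -, hQ'⟩ := exists_shortExact_injective_of_isPrimary Q hQ
    obtain ⟨y, rfl⟩ := Ext.covariant_sequence_exact₁ X hS e
      ((Ext.subsingleton_of_injective _ _ _).elim _ _) rfl
    obtain ⟨X', q, hX'f, hX', hq, h⟩ := ih hQ' y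
    refine ⟨X', q, hX'f, hX', hq, ?_⟩
    rw [← Ext.comp_assoc (h₁₂ := zero_add (n + 1)) (h₂₃ := rfl) (h := by lia), h, Ext.zero_comp]

end DiscMod

namespace FinDiscMod

variable {Γ : Type u} [Group Γ] [TopologicalSpace Γ] {ℓ : ℕ}

lemma finiteDiscretePrimary_le_openStabilizers (Γ : Type u) [Group Γ] [TopologicalSpace Γ]
    (ℓ : ℕ) : finiteDiscretePrimary ℤ Γ ℓ ≤ openStabilizers ℤ Γ := fun _ h => h.discrete

/-- The inclusion of the finite discrete `ℓ`-primary modules into the discrete modules. -/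
abbrev incl (Γ : Type u) [Group Γ] [TopologicalSpace Γ] (ℓ : ℕ) : FinDiscMod Γ ℓ ⥤ DiscMod Γ :=
  ObjectProperty.ιOfLE (finiteDiscretePrimary_le_openStabilizers Γ ℓ)

instance : (incl Γ ℓ).Additive := ⟨rfl⟩

/-- The object of `FinDiscMod Γ ℓ` given by a finite `ℓ`-primary discrete module. -/
abbrev of (M : DiscMod Γ) (hf : Finite M.V) (hp : IsPrimary ℓ M.V) : FinDiscMod Γ ℓ :=
  ⟨M.obj, ⟨hf, hp, M.property⟩⟩

lemma subsingleton_ext_iff [IsTopologicalGroup Γ] [CompactSpace Γ] [NeZero ℓ]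
    [HasExt.{w} (FinDiscMod Γ ℓ)] [HasExt.{v} (DiscMod Γ)] (X Y : FinDiscMod Γ ℓ) (n : ℕ) :
    Subsingleton (Ext X Y n) ↔ Subsingleton (Ext ((incl Γ ℓ).obj X) ((incl Γ ℓ).obj Y) n) := by
  have h := finiteDiscretePrimary_le_openStabilizers Γ ℓ
  have := preservesFiniteLimits_ιOfLE _ _ h
  have := preservesFiniteColimits_ιOfLE _ _ h
  refine (Equiv.ofBijective _ (mapExtAddHom_bijective_of_effaceable (incl Γ ℓ) (fun X Y n e => ?_)
    X Y n)).subsingleton_congr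
  have : Finite ((incl Γ ℓ).obj X).V := X.property.finite
  obtain ⟨X', p, hf, hp, _, hpe⟩ := DiscMod.exists_finite_epi_mk₀_comp_eq_zero
    (X := (incl Γ ℓ).obj X) (Q := (incl Γ ℓ).obj Y) X.property.primary Y.property.primary e
  let q : of X' hf hp ⟶ X := ObjectProperty.homMk p.hom
  have : Epi ((incl Γ ℓ).map q) := ‹Epi p›
  exact ⟨of X' hf hp, q, (incl Γ ℓ).epi_of_epi_map this, hpe⟩

end FinDiscMod

end FiniteModules

section Resolution

lemma subsingleton_topModuleCat_homology_iff {R : Type*} [Ring R] [TopologicalSpace R]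
    (S : ShortComplex (TopModuleCat R)) :
    Subsingleton S.homology ↔ ∀ x : S.X₂, S.g.hom x = 0 → ∃ y : S.X₁, S.f.hom y = x := by
  let f' : S.X₁ ⟶ TopModuleCat.ker S.g :=
    (TopModuleCat.isLimitKer S.g).lift (KernelFork.ofι S.f S.zero)
  have hf' (y : S.X₁) : (f'.hom y).1 = S.f.hom y :=
    congr(TopModuleCat.Hom.hom $((TopModuleCat.isLimitKer S.g).fac (KernelFork.ofι S.f S.zero)
      WalkingParallelPair.zero) y)
  let D : S.LeftHomologyData := ⟨_, _, _, _, _, TopModuleCat.isLimitKer S.g, by simp,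
    TopModuleCat.isColimitCoker _⟩
  rw [((forget (TopModuleCat R)).mapIso D.homologyIso).toEquiv.subsingleton_congr]
  change Subsingleton (TopModuleCat.ker S.g ⧸ f'.hom.range) ↔ _
  rw [Submodule.Quotient.subsingleton_iff, eq_top_iff]
  refine ⟨fun h x hx => ?_, ?_⟩
  · obtain ⟨y, hy⟩ := h (x := ⟨x, hx⟩) Submodule.mem_top
    exact ⟨y, (hf' y).symm.trans congr(($hy).1)⟩
  · rintro h ⟨x, hx⟩ -
    obtain ⟨y, hy⟩ := h x hx
    exact ⟨y, Subtype.ext ((hf' y).trans hy)⟩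

variable {k : Type v} [CommRing k] [TopologicalSpace k] {Γ : Type u} [Group Γ]
  [TopologicalSpace Γ] [IsTopologicalGroup Γ]

lemma subsingleton_continuousCohomology_succ_iff (T : TopRep.{u} k Γ) (n : ℕ) :
    Subsingleton (continuousCohomology (n + 1) T) ↔
      ∀ x, ((TopRep.homogeneousCochains T).d (n + 1) (n + 2)).hom x = 0 →
        ∃ y, ((TopRep.homogeneousCochains T).d n (n + 1)).hom y = x := by
  rw [((forget (TopModuleCat k)).mapIso ((TopRep.homogeneousCochains T).homologyIsoSc' n (n + 1)
    (n + 2) (by simp) (by simp))).toEquiv.subsingleton_congr]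
  exact subsingleton_topModuleCat_homology_iff _

/-- Evaluation at `1` is a (non-equivariant) contraction of the standard resolution. -/
lemma exists_d_eq_of_d_succ_eq_zero (T : TopRep.{u} k Γ) (n : ℕ) (f : (T.resolutionX (n + 1)).V)
    (hf : (T.d (n + 1)).hom f = 0) : ∃ e, (T.d n).hom e = f := by
  have h : f - (T.d n).hom ((show C(Γ, (T.resolutionX n).V) from f) 1) = 0 :=
    congr((show C(Γ, (T.resolutionX (n + 1)).V) from $hf) 1)
  exact ⟨_, (sub_eq_zero.1 h).symm⟩

lemma resolutionMap_injective {T T' : TopRep.{u} k Γ}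
    (i : TopRep.res (ContinuousMonoidHom.id Γ : Γ →* Γ) T ⟶ T')
    (hi : Function.Injective i.hom) (n : ℕ) :
    Function.Injective (ContinuousCohomology.resolutionMap (ContinuousMonoidHom.id Γ) i n).hom := by
  induction n with
  | zero => exact hi
  | succ n ih =>
    exact fun a b h => ContinuousMap.ext fun x =>
      ih congr((show C(Γ, (T'.resolutionX n).V) from $h) x)

variable [CompactSpace Γ] [DiscreteTopology k]

/-- Cochains take finitely many values by compactness. -/
lemma exists_module_finite_subset_range_resolutionMap (T : TopRep.{u} k Γ) [IsDiscreteTopRep T]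
    (n : ℕ) {s : Set (T.resolutionX n).V} (hs : s.Finite) :
    ∃ (W : DiscRep k Γ) (i : TopRep.res (ContinuousMonoidHom.id Γ : Γ →* Γ) W.toTopRep ⟶ T),
      Module.Finite k W.V ∧ Function.Injective i.hom ∧
      s ⊆ Set.range (ContinuousCohomology.resolutionMap (ContinuousMonoidHom.id Γ) i n).hom := by
  induction n with
  | zero =>
    obtain ⟨W, i, hi, hW, hs⟩ :=
      DiscRep.exists_module_finite_of_finite (DiscRep.ofTopRep T) hs
    let i' : TopRep.res (ContinuousMonoidHom.id Γ : Γ →* Γ) W.toTopRep ⟶ T := TopRep.ofHom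
      { toLinearMap := DiscRep.toLinearMap i
        cont := continuous_of_discreteTopology (α := W.toTopRep.V)
        isIntertwining' := fun g => ContinuousLinearMap.ext fun w => DiscRep.toLinearMap_ρ i g w }
    exact ⟨W, i', hW, hi, hs⟩
  | succ n ih =>
    let values := ⋃ f ∈ s, Set.range (show C(Γ, (T.resolutionX n).V) from f)
    have values_finite : values.Finite := hs.biUnion fun f _ =>
      (isCompact_range (show C(Γ, (T.resolutionX n).V) from f).continuous).finite_of_discrete
    obtain ⟨W, i, hW, hi, hvalues⟩ := ih values_finite
    refine ⟨W, i, hW, hi, fun (f : C(Γ, (T.resolutionX n).V)) hf => ?_⟩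
    let j := (ContinuousCohomology.resolutionMap (ContinuousMonoidHom.id Γ) i n).hom
    have hfj (x : Γ) : ∃ w, j w = f x := hvalues (Set.mem_biUnion hf ⟨x, rfl⟩)
    let lift : C((T.resolutionX n).V, (W.toTopRep.resolutionX n).V) :=
      ⟨Function.invFun j, continuous_of_discreteTopology⟩
    exact ⟨(lift.comp f : C(Γ, (W.toTopRep.resolutionX n).V)),
      ContinuousMap.ext fun x => Function.invFun_eq (hfj x)⟩

lemma subsingleton_continuousCohomology_succ_of_module_finite (T : TopRep.{u} k Γ)
    [IsDiscreteTopRep T] (n : ℕ)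
    (h : ∀ (W : DiscRep k Γ) (i : W.V →ₗ[k] T.V), Module.Finite k W.V → Function.Injective i →
      Subsingleton (continuousCohomology (n + 1) W.toTopRep)) :
    Subsingleton (continuousCohomology (n + 1) T) := by
  refine (subsingleton_continuousCohomology_succ_iff T n).2 fun f hf => ?_
  obtain ⟨W, i, hW, hi, hs⟩ :=
    exists_module_finite_subset_range_resolutionMap T (n + 2) (Set.finite_singleton f.1)
  let φ := ContinuousCohomology.cochainsMap (ContinuousMonoidHom.id Γ) i
  have hφ (m : ℕ) : Function.Injective (φ.f m).hom := fun a b hab =>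
    Subtype.ext (resolutionMap_injective i hi (m + 1) congr(($hab).1))
  obtain ⟨a, ha⟩ := hs rfl
  have hinv (g : Γ) : (W.toTopRep.resolutionX (n + 2)).ρ g a = a :=
    resolutionMap_injective i hi (n + 2) <|
      ((TopRep.hom_comm_apply _ g a).trans (by rw [ha]; exact f.2 g)).trans ha.symm
  obtain rfl : (φ.f (n + 1)).hom ⟨a, hinv⟩ = f := Subtype.ext ha
  have comm (m : ℕ) (x) : ((TopRep.homogeneousCochains T).d m (m + 1)).hom ((φ.f m).hom x) =
      (φ.f (m + 1)).hom (((TopRep.homogeneousCochains W.toTopRep).d m (m + 1)).hom x) :=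
    congr(($(φ.comm m (m + 1))).hom x)
  obtain ⟨e, he⟩ := (subsingleton_continuousCohomology_succ_iff _ n).1
    (h W ⟨⟨i.hom, map_add _⟩, map_smul _⟩ hW hi) ⟨a, hinv⟩
    (hφ (n + 2) (((comm (n + 1) _).symm.trans hf).trans (map_zero _).symm))
  exact ⟨(φ.f n).hom e, by rw [comm, he]⟩

end Resolution

namespace DiscMod

open DiscRep (V ofTopRep ofTopRepMap)

variable {Γ : Type u} [Group Γ] [TopologicalSpace Γ] [IsTopologicalGroup Γ] [CompactSpace Γ]

/-- The differential of the standard resolution of a discrete topological representation, as a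
morphism of discrete modules. -/
def resolutionD (T : TopRep.{u} ℤ Γ) [IsDiscreteTopRep T] (n : ℕ) :
    ofTopRep (T.resolutionX n) ⟶ ofTopRep (T.resolutionX (n + 1)) :=
  ofTopRepMap (T.d n)

/-- The homogeneous cochains of `T` as morphisms from `ℤ` to the standard resolution. -/
def homogeneousCochainsEquiv (T : TopRep.{u} ℤ Γ) [IsDiscreteTopRep T] (n : ℕ) :
    (unit Γ ⟶ ofTopRep (T.resolutionX (n + 1))) ≃ (TopRep.homogeneousCochains T).X n :=
  unitHomEquiv

lemma homogeneousCochainsEquiv_d (T : TopRep.{u} ℤ Γ) [IsDiscreteTopRep T] (n : ℕ)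
    (f : unit Γ ⟶ ofTopRep (T.resolutionX (n + 1))) :
    homogeneousCochainsEquiv T (n + 1) (f ≫ resolutionD T (n + 1)) =
      ((TopRep.homogeneousCochains T).d n (n + 1)).hom (homogeneousCochainsEquiv T n f) :=
  Subtype.ext (TopRep.homogeneousCochains.d_apply T n (homogeneousCochainsEquiv T n f)).symm

universe w

lemma subsingleton_continuousCohomology_iff_subsingleton_ext [HasExt.{w} (DiscMod Γ)]
    (T : TopRep.{u} ℤ Γ) [IsDiscreteTopRep T] (n : ℕ) :
    Subsingleton (continuousCohomology (n + 1) T) ↔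
      Subsingleton (Ext (unit Γ) (ofTopRep T) (n + 1)) := by
  have hd (m : ℕ) : resolutionD T m ≫ resolutionD T (m + 1) = 0 :=
    DiscRep.hom_ext fun f => congr(($(T.d_comp_d m)).hom f)
  have hex (m : ℕ) : (ShortComplex.mk _ _ (hd m)).Exact :=
    (DiscRep.exact_iff _).2 (exists_d_eq_of_d_succ_eq_zero T m)
  have : Mono (resolutionD T 0) := (DiscRep.mono_iff _).2 fun a b h =>
    congr((show C(Γ, T.V) from $h) 1)
  rw [subsingleton_continuousCohomology_succ_iff,
    subsingleton_ext_iff_of_acyclic_resolution (unit Γ) n _ _ (fun m => hd (m + 1))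
    (fun m => hex (m + 1)) (fun m j => DiscRep.subsingleton_ext_coind_of_projective _ _ j)
    (resolutionD T 0) (hd 0) (hex 0)]
  refine ((homogeneousCochainsEquiv T (n + 1)).forall_congr fun f => imp_congr ?_ ?_).symm
  · rw [← homogeneousCochainsEquiv_d]
    exact ((homogeneousCochainsEquiv T (n + 2)).injective.eq_iff' rfl).symm
  · refine (homogeneousCochainsEquiv T n).exists_congr fun g => ?_
    rw [← homogeneousCochainsEquiv_d, EmbeddingLike.apply_eq_iff_eq]

end DiscMod

section Torsion

universe w

variable {C : Type u} [Category.{v} C] [Abelian C] [HasExt.{w} C] {X Y : C}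

lemma mk₀_nsmul_id_comp {n : ℕ} (x : Ext X Y n) (m : ℕ) :
    (Ext.mk₀ (m • 𝟙 X)).comp x (zero_add n) = m • x := by
  induction m with
  | zero => simp
  | succ m ih => rw [succ_nsmul, Ext.mk₀_add, Ext.add_comp, ih, Ext.mk₀_id_comp, succ_nsmul]

lemma comp_mk₀_nsmul_id {n : ℕ} (x : Ext X Y n) (m : ℕ) :
    x.comp (Ext.mk₀ (m • 𝟙 Y)) (add_zero n) = m • x := by
  induction m with
  | zero => simp
  | succ m ih => rw [succ_nsmul, Ext.mk₀_add, Ext.comp_add, ih, Ext.comp_mk₀_id, succ_nsmul]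

/-- `Ext X N n` is `m`-divisible and killed by a power of `m`. -/
lemma subsingleton_ext_of_shortExact_nsmul_id {Z N : C} {m k : ℕ} {p : X ⟶ Z}
    {w : (m • 𝟙 X) ≫ p = 0} (hS : (ShortComplex.mk _ _ w).ShortExact) (hN : m ^ k • 𝟙 N = 0) (n : ℕ)
    (h : Subsingleton (Ext Z N (n + 1))) : Subsingleton (Ext X N n) := by
  have surjective_nsmul : Function.Surjective fun x : Ext X N n => m • x := fun x => by
    obtain ⟨y, hy⟩ := Ext.contravariant_sequence_exact₁ hS N x (add_comm 1 n) (h.elim _ _)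
    exact ⟨y, (mk₀_nsmul_id_comp y m).symm.trans hy⟩
  refine subsingleton_of_forall_eq 0 fun x => ?_
  obtain ⟨y, rfl⟩ := surjective_nsmul.iterate k x
  rw [smul_iterate_apply, ← comp_mk₀_nsmul_id, hN, Ext.mk₀_zero, Ext.comp_zero]

end Torsion

namespace DiscMod

universe w

open DiscRep (V toLinearMap ofLinearMap toLinearMap_ρ ihom ihomEquiv)

variable {Γ : Type u} [Group Γ] [TopologicalSpace Γ] {ℓ : ℕ}

lemma toLinearMap_nsmul_id (N : DiscMod Γ) (m : ℕ) (x : N.V) :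
    toLinearMap (m • 𝟙 N) x = m • x := by
  induction m with
  | zero => simp
  | succ m ih =>
    rw [succ_nsmul, succ_nsmul, ← ih]
    rfl

section ZMod

/-- The trivial module `ℤ/ℓ`. -/
abbrev zmod (Γ : Type u) [Group Γ] [TopologicalSpace Γ] (ℓ : ℕ) : DiscMod Γ :=
  DiscRep.trivial ℤ Γ (ULift.{u} (ZMod ℓ))

/-- The projection from `ℤ` to `ℤ/ℓ`. -/
def toZMod (Γ : Type u) [Group Γ] [TopologicalSpace Γ] (ℓ : ℕ) : unit Γ ⟶ zmod Γ ℓ :=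
  ofLinearMap (ULift.moduleEquiv.symm.toLinearMap ∘ₗ Algebra.linearMap ℤ (ZMod ℓ) ∘ₗ
    ULift.moduleEquiv.toLinearMap) fun _ _ => rfl

variable [IsTopologicalGroup Γ]

lemma shortExact_toZMod [NeZero ℓ] :
    ∃ w : (ℓ • 𝟙 (unit Γ)) ≫ toZMod Γ ℓ = 0, (ShortComplex.mk _ _ w).ShortExact := by
  have mul_apply (n : ℤ) :
      toLinearMap (ℓ • 𝟙 (unit Γ)) (⟨n⟩ : ULift ℤ) = (⟨ℓ * n⟩ : ULift ℤ) :=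
    (toLinearMap_nsmul_id _ _ _).trans (ULift.ext _ _ (nsmul_eq_mul ℓ n))
  refine ⟨DiscRep.hom_ext fun ⟨n⟩ => ?_, (DiscRep.shortExact_iff _).2 ⟨?_, ?_, ?_⟩⟩
  · refine (congrArg (toLinearMap (toZMod Γ ℓ)) (mul_apply n)).trans (ULift.ext _ _ ?_)
    change ((ℓ * n : ℤ) : ZMod ℓ) = 0
    simp
  · rintro ⟨a⟩ ⟨b⟩ h
    have h' := congrArg ULift.down ((mul_apply a).symm.trans (h.trans (mul_apply b)))
    exact ULift.ext _ _ (mul_left_cancel₀ (Nat.cast_ne_zero.2 (NeZero.ne ℓ)) h')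
  · rintro ⟨x⟩
    obtain ⟨n, rfl⟩ := ZMod.intCast_surjective x
    exact ⟨(⟨n⟩ : ULift ℤ), rfl⟩
  · rintro ⟨n⟩ hn
    obtain ⟨m, rfl⟩ := (ZMod.intCast_zmod_eq_zero_iff_dvd n ℓ).1 (congrArg ULift.down hn)
    exact ⟨(⟨m⟩ : ULift ℤ), mul_apply m⟩

lemma isPrimary_zmod (Γ : Type u) [Group Γ] [TopologicalSpace Γ] (ℓ : ℕ) :
    IsPrimary ℓ (zmod Γ ℓ).V :=
  fun (x : ULift (ZMod ℓ)) => ⟨1, show ℓ ^ 1 • x = 0 from ULift.ext _ _ (by simp)⟩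

variable [HasExt.{w} (DiscMod Γ)]

lemma subsingleton_ext_unit_of_zmod [NeZero ℓ] {N : DiscMod Γ} [Finite N.V] (hN : IsPrimary ℓ N.V)
    (n : ℕ) (h : Subsingleton (Ext (zmod Γ ℓ) N (n + 1))) : Subsingleton (Ext (unit Γ) N n) := by
  obtain ⟨w, hS⟩ := shortExact_toZMod (Γ := Γ) (ℓ := ℓ)
  obtain ⟨k, hk⟩ := hN.exists_pow_of_finite Set.finite_univ
  have nsmul_id_eq_zero : ℓ ^ k • 𝟙 N = 0 := DiscRep.hom_ext fun m =>
    (toLinearMap_nsmul_id N (ℓ ^ k) m).trans (hk m (Set.mem_univ m))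
  exact subsingleton_ext_of_shortExact_nsmul_id hS nsmul_id_eq_zero n h

lemma not_subsingleton_ext_zmod_one (hℓ : 1 < ℓ) :
    ¬ Subsingleton (Ext (zmod Γ ℓ) (zmod Γ ℓ) 1) := fun h => by
  have : NeZero ℓ := ⟨hℓ.ne_bot⟩
  have : Fact (1 < ℓ) := ⟨hℓ⟩
  have := subsingleton_ext_unit_of_zmod (isPrimary_zmod Γ ℓ) 0 h
  have toZMod_eq_zero : toZMod Γ ℓ = 0 := (Ext.mk₀_bijective _ _).1 (Subsingleton.elim _ _)
  have h1 : ((1 : ℤ) : ZMod ℓ) = 0 :=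
    congr(ULift.down (toLinearMap $toZMod_eq_zero (⟨1⟩ : ULift ℤ)))
  simp at h1

end ZMod

section InternalHom

variable [IsTopologicalGroup Γ] {X : DiscMod Γ} [Module.Finite ℤ X.V]

/-- The tensor-hom adjunction between `X ⊗ -` and the internal `Hom` out of `X`, at the unit. -/
noncomputable def unitIhomEquiv {N : DiscMod Γ} : (unit Γ ⟶ (ihom X).obj N) ≃ (X ⟶ N) :=
  unitHomEquiv.trans <|
    (Representation.linHom.invariantsEquivRepHom X.obj N.obj).toEquiv.trans
      (openStabilizers ℤ Γ).fullyFaithfulι.homEquiv.symm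

lemma unitIhomEquiv_comp {N N' : DiscMod Γ} (f : unit Γ ⟶ (ihom X).obj N) (p : N ⟶ N') :
    unitIhomEquiv (f ≫ (ihom X).map p) = unitIhomEquiv f ≫ p := rfl

variable [CompactSpace Γ] [HasExt.{w} (DiscMod Γ)]

/-- Both sides are shifted along an injective resolution of `Q` with divisible terms, on which the
internal `Hom` is exact. -/
lemma subsingleton_ext_of_ihom {Q : DiscMod Γ} (hQd : IsDivisible Q.V) (hQ : IsPrimary ℓ Q.V)
    (n : ℕ) (h : Subsingleton (Ext (unit Γ) ((ihom X).obj Q) (n + 1))) :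
    Subsingleton (Ext X Q (n + 1)) := by
  induction n generalizing Q with
  | zero =>
    obtain ⟨J, Q', i, p, w, hS, hJ, -⟩ := exists_shortExact_injective_of_isPrimary Q hQ
    have hS' := DiscRep.shortExact_map_ihom X hS (hS₁ := isDivisible_iff_module_injective.1 hQd)
    refine subsingleton_ext_one_of_exists_lift hS X (Ext.subsingleton_of_injective _ _ _)
      fun f => ?_
    obtain ⟨g, hg⟩ := exists_lift_of_subsingleton_ext_one hS' (unit Γ) h (unitIhomEquiv.symm f)
    exact ⟨unitIhomEquiv g, (unitIhomEquiv_comp g p).symm.trans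
      ((congrArg unitIhomEquiv hg).trans (unitIhomEquiv.apply_symm_apply f))⟩
  | succ n ih =>
    obtain ⟨J, Q', i, p, w, hS, hJ, -, -, hQd', hQ'⟩ :=
      exists_shortExact_injective_of_isPrimary Q hQ
    have hS' := DiscRep.shortExact_map_ihom X hS (hS₁ := isDivisible_iff_module_injective.1 hQd)
    refine subsingleton_ext_X₁_of_shortExact hS X (ih hQd' hQ' ?_)
      (Ext.subsingleton_of_injective _ _ _)
    exact subsingleton_ext_X₃_of_shortExact hS' (unit Γ)
      (DiscRep.subsingleton_ext_ihom_of_injective X (unit Γ) J n) h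

end InternalHom

end DiscMod

section Dimension

universe w

lemma homologicalDimension_le_iff {C : Type u} [Category.{v} C] [Abelian C] [HasExt.{w} C]
    {m : ℕ∞} : homologicalDimension C ≤ m ↔
      ∀ i : ℕ, m < i → ∀ X Y : C, Subsingleton (Ext X Y i) := by
  let := HasExt.standard C
  have chgUniv (X Y : C) (i : ℕ) :
      Subsingleton (Ext.{max u v} X Y i) ↔ Subsingleton (Ext.{w} X Y i) :=
    Ext.chgUniv.subsingleton_congr
  refine ⟨fun h i hi X Y => (chgUniv X Y i).1 ?_,
    fun h => sInf_le fun i hi X Y => (chgUniv X Y i).2 (h i hi X Y)⟩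
  exact csInf_mem (s := {n : ℕ∞ | ∀ i : ℕ, n < (i : ℕ∞) → ∀ X Y : C,
    Subsingleton (Ext.{max u v} X Y i)}) ⟨⊤, fun i hi => absurd hi (by simp)⟩ i (h.trans_lt hi) X Y

variable {Γ : Type u} [Group Γ] [TopologicalSpace Γ] [IsTopologicalGroup Γ] {ℓ : ℕ}

lemma cohomologicalDimension_le_iff {m : ℕ∞} : cohomologicalDimension Γ ℓ ≤ m ↔
    ∀ i : ℕ, m < i → ∀ (T : TopRep.{u} ℤ Γ) [IsDiscreteTopRep T], IsPrimary ℓ T.V →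
      Subsingleton (continuousCohomology i T) := by
  refine ⟨fun h i hi T _ hT => ?_, fun h => sInf_le fun i hi T h₁ h₂ hT =>
    have : IsDiscreteTopRep T := ⟨h₁, h₂⟩
    h i hi T hT⟩
  exact csInf_mem (s := {n : ℕ∞ | ∀ i : ℕ, n < (i : ℕ∞) → ∀ M : TopRep.{u} ℤ Γ,
    DiscreteTopology M.V → (∀ m : M.V, IsOpen {g : Γ | M.ρ g m = m}) →
    (∀ m : M.V, ∃ k : ℕ, ℓ ^ k • m = 0) → Subsingleton (continuousCohomology i M)})
    ⟨⊤, fun i hi => absurd hi (by simp)⟩ i (h.trans_lt hi) T IsDiscreteTopRep.discreteTopology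
    IsDiscreteTopRep.isOpen_stabilizer hT

variable [CompactSpace Γ]

lemma homologicalDimension_le_cohomologicalDimension_add_one [NeZero ℓ] :
    homologicalDimension (FinDiscMod Γ ℓ) ≤ cohomologicalDimension Γ ℓ + 1 := by
  have := HasExt.standard (FinDiscMod Γ ℓ)
  have := HasExt.standard (DiscMod Γ)
  refine homologicalDimension_le_iff.2 fun i hi X Y => ?_
  obtain ⟨n, rfl⟩ : ∃ n, i = n + 2 :=
    Nat.exists_eq_add_of_le' (by exact_mod_cast le_add_self.trans_lt hi)
  have hn : cohomologicalDimension Γ ℓ < (n + 1 : ℕ) := lt_of_add_lt_add_right (a := 1) hi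
  rw [FinDiscMod.subsingleton_ext_iff]
  let X' := (FinDiscMod.incl Γ ℓ).obj X
  let Y' := (FinDiscMod.incl Γ ℓ).obj Y
  have : Finite X'.V := X.property.finite
  obtain ⟨J, Q, i, p, w, hS, hJ, -, -, hQd, hQ⟩ :=
    DiscMod.exists_shortExact_injective_of_isPrimary Y' Y.property.primary
  refine subsingleton_ext_X₁_of_shortExact hS X' (DiscMod.subsingleton_ext_of_ihom hQd hQ n ?_)
    (Ext.subsingleton_of_injective _ _ _)
  let H := (DiscRep.ihom X').obj Q
  exact (DiscMod.subsingleton_continuousCohomology_iff_subsingleton_ext H.toTopRep n).1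
    (cohomologicalDimension_le_iff.1 le_rfl (n + 1) hn H.toTopRep
      (DiscMod.isPrimary_ihom (X := X') X.property.primary Q))

lemma one_le_homologicalDimension (hℓ : 1 < ℓ) : 1 ≤ homologicalDimension (FinDiscMod Γ ℓ) := by
  have : NeZero ℓ := ⟨hℓ.ne_bot⟩
  have := HasExt.standard (FinDiscMod Γ ℓ)
  have := HasExt.standard (DiscMod Γ)
  by_contra! h
  let F : FinDiscMod Γ ℓ := .of (.zmod Γ ℓ) inferInstance (DiscMod.isPrimary_zmod Γ ℓ)
  exact DiscMod.not_subsingleton_ext_zmod_one hℓ ((FinDiscMod.subsingleton_ext_iff F F 1).1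
    (homologicalDimension_le_iff.1 le_rfl 1 h F F))

lemma cohomologicalDimension_le_of_homologicalDimension_le [NeZero ℓ] {m : ℕ∞}
    (hm : homologicalDimension (FinDiscMod Γ ℓ) ≤ m + 1) : cohomologicalDimension Γ ℓ ≤ m := by
  have := HasExt.standard (FinDiscMod Γ ℓ)
  have := HasExt.standard (DiscMod Γ)
  refine cohomologicalDimension_le_iff.2 fun i hi T _ hT => ?_
  obtain ⟨n, rfl⟩ : ∃ n, i = n + 1 :=
    Nat.exists_eq_add_of_le' (by exact_mod_cast pos_of_gt hi)
  refine subsingleton_continuousCohomology_succ_of_module_finite T n fun W i _ hi' => ?_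
  have hW : IsPrimary ℓ W.V := hT.of_injective i.toAddMonoidHom hi'
  have : Finite W.V := DiscMod.finite_of_isPrimary W hW
  refine (DiscMod.subsingleton_continuousCohomology_iff_subsingleton_ext _ n).2
    (DiscMod.subsingleton_ext_unit_of_zmod hW (n + 1) ?_)
  have hn : m + 1 < (n + 1 + 1 : ℕ) := (ENat.add_lt_add_iff_right (by simp)).2 hi
  exact (FinDiscMod.subsingleton_ext_iff
    (.of (.zmod Γ ℓ) inferInstance (DiscMod.isPrimary_zmod Γ ℓ)) (.of W ‹_› hW) _).1
    (homologicalDimension_le_iff.1 hm _ hn _ _)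

end Dimension

theorem mainTheorem8_general (Γ : Type u) [Group Γ] [TopologicalSpace Γ] [IsTopologicalGroup Γ]
    [CompactSpace Γ] (ℓ : ℕ) (hℓ : 1 < ℓ) :
    homologicalDimension (FinDiscMod Γ ℓ) = cohomologicalDimension Γ ℓ + 1 := by
  have : NeZero ℓ := ⟨hℓ.ne_bot⟩
  refine le_antisymm homologicalDimension_le_cohomologicalDimension_add_one ?_
  obtain ⟨m, hm⟩ := exists_add_of_le (one_le_homologicalDimension (Γ := Γ) hℓ)
  rw [add_comm] at hm
  rw [hm]
  gcongr
  exact cohomologicalDimension_le_of_homologicalDimension_le hm.le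

theorem mainTheorem8 (Γ : Type u) [Group Γ] [TopologicalSpace Γ] [IsTopologicalGroup Γ]
    [CompactSpace Γ] [TotallyDisconnectedSpace Γ] (ℓ : ℕ) (hℓ : ℓ.Prime) :
    homologicalDimension (FinDiscMod Γ ℓ) = cohomologicalDimension Γ ℓ + 1 :=
  mainTheorem8_general Γ ℓ hℓ.one_lt
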